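/- Let $q$ and $a$ be two independent indeterminates. For an integer $m$ write $[m]_q=\dfrac{1-q^m}{1-q}$ and $[m]=[m]_q$ (so $[m]_{q^2}=\dfrac{1-q^{2m}}{1-q^2}$), and for an integer $k\ge 0$ write $(x;q)_k=(1-x)(1-xq)\cdots(1-xq^{k-1})$. For rational functions $A,B$ in $q$ and $a$ and a nonzero polynomial $P\in\mathbb{Z}[q,a]$, the congruence $A\equiv B\pmod P$ means that $A-B=P\,N/D$ for some $N,D\in\mathbb{Z}[q,a]$ with $D\neq 0$ and $D$ coprime to $P$ (i.e. $P$ divides the numerator of $A-B$ in lowest terms). **Theorem.** Let $n\equiv 1\pmod 4$ be a positive integer. Then, modulo $[n]_{q^2}(1-aq^{2n})(a-q^{2n})$, $$\sum_{k=0}^{(n-1)/4}[8k+1]_{q^2}[8k+1]^2\,\frac{(q^2;q^8)_k^2\,(aq^2;q^8)_k\,(q^2/a;q^8)_k}{(q^8;q^8)_k^2\,(aq^8;q^8)_k\,(q^8/a;q^8)_k}\,q^{-4k}$$ $$\equiv\ [n]_{q^2}\,\frac{(q^4;q^8)_{(n-1)/4}}{(q^8;q^8)_{(n-1)/4}}\,q^{-(n-1)/2}\left(1-\frac{(1-aq^2)(1-q^2/a)}{(1-q)^2(1+q^2)}\right).$$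 -/

import Mathlib

open Finset

/-- The `q`-shifted factorial `(x; q)_k = (1 - x)(1 - x q) ⋯ (1 - x q^(k-1))`. -/
def qPochhammer {K : Type*} [Field K] (x q : K) (k : ℕ) : K :=
  ∏ i ∈ range k, (1 - x * q ^ i)

/-- The `q`-integer `[m]_q = (1 - q^m) / (1 - q)`. -/
def qInteger {K : Type*} [Field K] (q : K) (m : ℤ) : K :=
  (1 - q ^ m) / (1 - q)

/-- Congruence of fractions modulo an element `P` of the base domain `R`: the difference of the
two fractions can be written as `P N / D` with `N, D` in `R` and `D` nonzero and coprime to `P`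
(no common factor other than units). For a factorial domain `R` this says that `P` divides the
numerator of the difference in lowest terms and is coprime to the denominator. The modulus is
given as a fraction; that it lies in `R` is part of the assertion. -/
def FracCongr (R : Type*) [CommRing R] [IsDomain R] {K : Type*} [Field K] [Algebra R K]
    (A B P : K) : Prop :=
  ∃ p N D : R, algebraMap R K p = P ∧ D ≠ 0 ∧ IsRelPrime D p ∧
    A - B = P * (algebraMap R K N / algebraMap R K D)

/-- The polynomial ring `ℤ[q, a]` in two indeterminates. -/
abbrev PolyQA : Type := MvPolynomial (Fin 2) ℤ

/-- The field of rational functions in two indeterminates `q` and `a`. -/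
abbrev RatQA : Type := FractionRing PolyQA

/-- The indeterminate `q`, as a rational function. -/
noncomputable def varQ : RatQA := algebraMap PolyQA RatQA (MvPolynomial.X 0)

/-- The indeterminate `a`, as a rational function. -/
noncomputable def varA : RatQA := algebraMap PolyQA RatQA (MvPolynomial.X 1)

/-! The modulus is squarefree in the factorial ring ℤ[q, a], so the congruence can be tested at one
prime factor π at a time: the difference of the two sides must be regular at π and reduce to zero in
a field where exactly the multiples of π vanish (`FracCongr.of_specializesTo`). Let n = 4m + 1 and
let ζ, α be the images of q, a in such a field.

If π divides 1 - a q^(2n) or a - q^(2n), then α = ζ^(±2n) and ζ is neither zero nor a root of unity.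
No denominator vanishes, and the reduced sides are equal (`sum_truncatedTerm`). By the symmetry a →
1/a, take α = ζ^(2n). With Q = ζ^8 one numerator parameter is then Q^(-m), and the summand is, up to
a constant, a terminating ₆φ₅ summand times Q^(-k) + ζ² Q^k - 2ζ. This factor is a constant plus a
factor whose only effect is to shift the parameter c to cQ, so two instances of the ₆φ₅ summation
(`sum_sixPhiFiveTerm`) give the closed form.

If π divides [n] in base q², the field has characteristic zero and ζ² has an order d > 1 dividing n.
Put m = ld + M with M < d. The reduced summands at k and M - k are opposite
(`truncatedTerm_reflect`) and those with M < k < d vanish, so the first d of them sum to zero. Each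
later block of d summands reduces to a constant multiple of the first
(`exists_specializesTo_truncatedTerm_add`), and the last, incomplete block contains exactly the
indices 0, …, M. So the sum reduces to zero, as does the closed form because of its factor [n]. -/

/-- `x` is a fraction `N / D` whose denominator does not vanish under `φ`, and `y = φ N / φ D`. -/
def SpecializesTo {R K L : Type*} [CommRing R] [Field K] [Algebra R K] [Field L] (φ : R →+* L)
    (x : K) (y : L) : Prop :=
  ∃ N D : R, φ D ≠ 0 ∧ x * algebraMap R K D = algebraMap R K N ∧ y * φ D = φ N

/-! ### Arithmetic of reductions. -/

namespace SpecializesTo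

variable {R K L : Type*} [CommRing R] [Field K] [Algebra R K] [Field L] {φ : R →+* L}
  {x x' : K} {y y' : L}

lemma of_algebraMap (φ : R →+* L) (r : R) : SpecializesTo φ (algebraMap R K r) (φ r) :=
  ⟨r, 1, by simp, by simp, by simp⟩

lemma one : SpecializesTo φ (1 : K) (1 : L) := ⟨1, 1, by simp, by simp, by simp⟩

lemma zero : SpecializesTo φ (0 : K) (0 : L) := ⟨0, 1, by simp, by simp, by simp⟩

lemma mul (h : SpecializesTo φ x y) (h' : SpecializesTo φ x' y') :
    SpecializesTo φ (x * x') (y * y') := by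
  obtain ⟨N, D, hD, hx, hy⟩ := h
  obtain ⟨N', D', hD', hx', hy'⟩ := h'
  refine ⟨N * N', D * D', by simp [hD, hD'], ?_, ?_⟩
  · rw [map_mul, map_mul, ← hx, ← hx']; ring
  · rw [map_mul, map_mul, ← hy, ← hy']; ring

lemma add (h : SpecializesTo φ x y) (h' : SpecializesTo φ x' y') :
    SpecializesTo φ (x + x') (y + y') := by
  obtain ⟨N, D, hD, hx, hy⟩ := h
  obtain ⟨N', D', hD', hx', hy'⟩ := h'
  refine ⟨N * D' + N' * D, D * D', by simp [hD, hD'], ?_, ?_⟩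
  · simp only [map_mul, map_add]; rw [← hx, ← hx']; ring
  · simp only [map_mul, map_add]; rw [← hy, ← hy']; ring

lemma neg (h : SpecializesTo φ x y) : SpecializesTo φ (-x) (-y) := by
  obtain ⟨N, D, hD, hx, hy⟩ := h
  exact ⟨-N, D, hD, by rw [map_neg, ← hx]; ring, by rw [map_neg, ← hy]; ring⟩

lemma sub (h : SpecializesTo φ x y) (h' : SpecializesTo φ x' y') :
    SpecializesTo φ (x - x') (y - y') := by
  simpa only [sub_eq_add_neg] using h.add h'.neg

/-- A nonzero value makes the numerator survive under φ, so the fraction may be turned over. This is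
the one operation with a side condition. -/
lemma inv [IsDomain R] [IsFractionRing R K] (h : SpecializesTo φ x y) (hy0 : y ≠ 0) :
    SpecializesTo φ x⁻¹ y⁻¹ := by
  obtain ⟨N, D, hD, hx, hy⟩ := h
  have hN : φ N ≠ 0 := by rw [← hy]; exact mul_ne_zero hy0 hD
  have hN' : algebraMap R K N ≠ 0 := by
    intro h0
    rw [IsFractionRing.to_map_eq_zero_iff] at h0
    exact hN (by simp [h0])
  have hx0 : x ≠ 0 := by
    rintro rfl
    exact hN' (by simpa using hx.symm)
  exact ⟨D, N, hN, by rw [← hx]; field_simp, by rw [← hy]; field_simp⟩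

lemma div [IsDomain R] [IsFractionRing R K] (h : SpecializesTo φ x y)
    (h' : SpecializesTo φ x' y') (hy0 : y' ≠ 0) : SpecializesTo φ (x / x') (y / y') := by
  simpa only [div_eq_mul_inv] using h.mul (h'.inv hy0)

lemma pow (h : SpecializesTo φ x y) (k : ℕ) : SpecializesTo φ (x ^ k) (y ^ k) := by
  induction k with
  | zero => simpa using one
  | succ k ih => simpa only [pow_succ] using ih.mul h

lemma sum {ι : Type*} (s : Finset ι) {f : ι → K} {g : ι → L}
    (h : ∀ i ∈ s, SpecializesTo φ (f i) (g i)) : SpecializesTo φ (∑ i ∈ s, f i) (∑ i ∈ s, g i) := by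
  classical
  induction s using Finset.induction_on with
  | empty => simpa using zero
  | insert i s hi ih =>
    rw [sum_insert hi, sum_insert hi]
    exact (h i (mem_insert_self i s)).add (ih fun j hj => h j (mem_insert_of_mem hj))

lemma prod {ι : Type*} (s : Finset ι) {f : ι → K} {g : ι → L}
    (h : ∀ i ∈ s, SpecializesTo φ (f i) (g i)) : SpecializesTo φ (∏ i ∈ s, f i) (∏ i ∈ s, g i) := by
  classical
  induction s using Finset.induction_on with
  | empty => simpa using one
  | insert i s hi ih =>
    rw [prod_insert hi, prod_insert hi]
    exact (h i (mem_insert_self i s)).mul (ih fun j hj => h j (mem_insert_of_mem hj))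

lemma qPochhammer (h : SpecializesTo φ x y) (h' : SpecializesTo φ x' y') (k : ℕ) :
    SpecializesTo φ (_root_.qPochhammer x x' k) (_root_.qPochhammer y y' k) :=
  prod _ fun i _ => one.sub (h.mul (h'.pow i))

end SpecializesTo

/-! ### Congruences tested at prime factors. -/

/-- In a factorial domain, a squarefree element divides every element that is divisible by all its
prime factors. -/
lemma Squarefree.dvd_of_forall_prime_dvd {R : Type*} [CommRing R] [IsDomain R]
    [UniqueFactorizationMonoid R] {p x : R} (hp0 : p ≠ 0) (hp : Squarefree p)
    (h : ∀ π, Prime π → π ∣ p → π ∣ x) : p ∣ x := by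
  induction p using UniqueFactorizationMonoid.induction_on_prime with
  | h₁ => exact absurd rfl hp0
  | h₂ u hu => exact hu.dvd
  | h₃ a π ha hπ ih =>
    have hs := (squarefree_mul_iff.1 hp)
    exact hs.1.mul_dvd (h π hπ (dvd_mul_right _ _))
      (ih ha hs.2.2 fun ρ hρ hd => h ρ hρ (hd.mul_left _))

/-- A congruence of fractions modulo a squarefree element of a factorial domain can be checked by
reducing modulo each prime factor of the modulus. -/
lemma FracCongr.of_specializesTo.{u, v} {R : Type u} {K : Type v} [CommRing R] [IsDomain R]
    [UniqueFactorizationMonoid R] [Field K] [Algebra R K] [IsFractionRing R K] {p : R}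
    (hp0 : p ≠ 0) (hp : Squarefree p) {A B : K}
    (h : ∀ π : R, Prime π → π ∣ p → ∀ (L : Type u) [Field L] (φ : R →+* L),
      (∀ x, φ x = 0 ↔ π ∣ x) → SpecializesTo φ (A - B) (0 : L)) :
    FracCongr R A B (algebraMap R K p) := by
  obtain ⟨N, D, hrel, hND⟩ := IsFractionRing.exists_reduced_fraction (A := R) (A - B)
  have hD0 : algebraMap R K D ≠ 0 := IsFractionRing.to_map_ne_zero_of_mem_nonZeroDivisors D.2
  -- The test field at π is the fraction field of R/(π). Comparing the reduced fraction N/D with one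
  -- whose denominator is prime to π moves the divisibility to N.
  have hdvd : p ∣ N := by
    refine Squarefree.dvd_of_forall_prime_dvd hp0 hp fun π hπ hπp => ?_
    have : (Ideal.span {π}).IsPrime := (Ideal.span_singleton_prime hπ.ne_zero).2 hπ
    let ψ : R →+* FractionRing (R ⧸ Ideal.span {π}) :=
      (algebraMap _ _).comp (Ideal.Quotient.mk (Ideal.span {π}))
    have key : ∀ x, ψ x = 0 ↔ π ∣ x := fun x => by
      rw [RingHom.comp_apply, IsFractionRing.to_map_eq_zero_iff, Ideal.Quotient.eq_zero_iff_mem,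
        Ideal.mem_span_singleton]
    obtain ⟨N', D', hD', hx, hy⟩ := h π hπ hπp _ ψ key
    rw [Ne, key] at hD'
    rw [zero_mul, eq_comm, key] at hy
    have e : N * D' = N' * D := by
      apply IsFractionRing.injective R K
      rw [map_mul, map_mul, ← hx, ← hND, IsFractionRing.mk'_eq_div]
      field_simp
    exact (hπ.dvd_or_dvd (e ▸ hy.mul_right _ : π ∣ N * D')).resolve_right hD'
  obtain ⟨M, rfl⟩ := hdvd
  refine ⟨p, M, D, rfl, nonZeroDivisors.ne_zero D.2, fun x hx hx' => hrel (hx'.mul_right _) hx, ?_⟩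
  rw [← hND, IsFractionRing.mk'_eq_div, map_mul, mul_div_assoc]

/-! ### Recurrences for q-shifted factorials. -/

section qPochhammer

variable {F : Type*} [Field F]

lemma qPochhammer_zero (x q : F) : qPochhammer x q 0 = 1 := by simp [qPochhammer]

lemma qPochhammer_succ (x q : F) (k : ℕ) :
    qPochhammer x q (k + 1) = qPochhammer x q k * (1 - x * q ^ k) := prod_range_succ _ _

lemma qPochhammer_succ' (x q : F) (k : ℕ) :
    qPochhammer x q (k + 1) = (1 - x) * qPochhammer (x * q) q k := by
  rw [qPochhammer, prod_range_succ', mul_comm, qPochhammer]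
  simp [pow_succ', mul_assoc]

lemma qPochhammer_ne_zero {x q : F} {k : ℕ} (h : ∀ i < k, 1 - x * q ^ i ≠ 0) :
    qPochhammer x q k ≠ 0 := prod_ne_zero_iff.2 fun i hi => h i (mem_range.1 hi)

lemma qPochhammer_add (x q : F) (j k : ℕ) :
    qPochhammer x q (j + k) = qPochhammer x q j * qPochhammer (x * q ^ j) q k := by
  simp only [qPochhammer, prod_range_add]
  congr 1
  exact prod_congr rfl fun i _ => by ring

end qPochhammer

/-! ### The terminating ₆φ₅ summation. -/

/-- The summand of the terminating very-well-poised `₆φ₅` series. -/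
def sixPhiFiveTerm {F : Type*} [Field F] (Q a b c : F) (m k : ℕ) : F :=
  ((1 - a * Q ^ (2 * k)) / (1 - a) * (qPochhammer a Q k / qPochhammer Q Q k)) *
    (qPochhammer b Q k / qPochhammer (a * Q / b) Q k) *
    (qPochhammer c Q k / qPochhammer (a * Q / c) Q k) *
    (qPochhammer (Q ^ m)⁻¹ Q k / qPochhammer (a * Q ^ (m + 1)) Q k) *
    (a * Q ^ (m + 1) / (b * c)) ^ k

section SixPhiFive

variable {F : Type*} [Field F] {Q : F}

/-- Only the last quotient and the power depend on m. Their difference produces (1 - Q^(j+1))(1 - a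
Q^(j+1)), which turns the leading factor into that for aQ². The prefactor is free of j, so summation
gives a recursion in m. -/
lemma sixPhiFiveTerm_succ_sub (hQ0 : Q ≠ 0) (hQ : ∀ k, 1 - Q * Q ^ k ≠ 0) {a b c : F}
    (ha' : ∀ k, 1 - a * Q ^ k ≠ 0) (m j : ℕ) :
    sixPhiFiveTerm Q a b c (m + 1) (j + 1) - sixPhiFiveTerm Q a b c m (j + 1) =
      -((1 - a * Q) * (1 - a * Q ^ 2) * (1 - b) * (1 - c) * (a * Q ^ (m + 1) / (b * c)) /
        ((1 - a * Q / b) * (1 - a * Q / c) * (1 - a * Q ^ (m + 1)) * (1 - a * Q ^ (m + 2)))) *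
      sixPhiFiveTerm Q (a * Q ^ 2) (b * Q) (c * Q) m j := by
  have n5 : 1 - a ≠ 0 := by simpa using ha' 0
  have hlead : (1 - a * Q ^ (2 * (j + 1))) / (1 - a) *
      (qPochhammer a Q (j + 1) / qPochhammer Q Q (j + 1)) *
      ((1 - Q * Q ^ j) * (1 - a * Q ^ (j + 1))) = (1 - a * Q) * (1 - a * Q ^ 2) *
      ((1 - a * Q ^ 2 * Q ^ (2 * j)) / (1 - a * Q ^ 2) *
        (qPochhammer (a * Q ^ 2) Q j / qPochhammer Q Q j)) := by
    have h1 : qPochhammer a Q (j + 1) * (1 - a * Q ^ (j + 1)) =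
        (1 - a) * ((1 - a * Q) * qPochhammer (a * Q ^ 2) Q j) := by
      rw [← qPochhammer_succ, qPochhammer_succ', qPochhammer_succ', mul_assoc a, ← sq]
    have p2 : qPochhammer Q Q j ≠ 0 := qPochhammer_ne_zero fun i _ => hQ i
    have n6 := ha' 2
    have n9 := hQ j
    rw [qPochhammer_succ Q Q j, show a * Q ^ 2 * Q ^ (2 * j) = a * Q ^ (2 * (j + 1)) by ring]
    trans (1 - a * Q ^ (2 * (j + 1))) / (1 - a) *
      ((qPochhammer a Q (j + 1) * (1 - a * Q ^ (j + 1))) / qPochhammer Q Q j)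
    · generalize 1 - a * Q ^ (2 * (j + 1)) = X
      generalize 1 - a * Q ^ (j + 1) = Y
      generalize 1 - Q * Q ^ j = Z at *
      field_simp
    · rw [h1]
      generalize 1 - a * Q ^ (2 * (j + 1)) = X
      generalize 1 - a * Q ^ 2 = Y at *
      field_simp
  have hwp : ∀ x : F, qPochhammer x Q (j + 1) / qPochhammer (a * Q / x) Q (j + 1) =
      (1 - x) / (1 - a * Q / x) *
        (qPochhammer (x * Q) Q j / qPochhammer (a * Q ^ 2 * Q / (x * Q)) Q j) := fun x => by
    rw [qPochhammer_succ', qPochhammer_succ', mul_div_mul_comm, mul_div_mul_right _ _ hQ0]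
    congr 3
    ring
  have hlast : qPochhammer (Q ^ (m + 1))⁻¹ Q (j + 1) / qPochhammer (a * Q ^ (m + 1 + 1)) Q (j + 1) *
      Q ^ (j + 1) - qPochhammer (Q ^ m)⁻¹ Q (j + 1) / qPochhammer (a * Q ^ (m + 1)) Q (j + 1) =
      - ((1 - Q * Q ^ j) * (1 - a * Q ^ (j + 1)) /
        ((1 - a * Q ^ (m + 1)) * (1 - a * Q ^ (m + 2)))) *
      (qPochhammer (Q ^ m)⁻¹ Q j / qPochhammer (a * Q ^ 2 * Q ^ (m + 1)) Q j) := by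
    have e4 : a * Q ^ 2 * Q ^ (m + 1) = a * Q ^ (m + 3) := by ring
    have n1 := ha' (m + 1)
    have n2 := ha' (m + 2)
    have n3 := ha' (m + j + 2)
    have h2 : qPochhammer (Q ^ (m + 1))⁻¹ Q (j + 1) =
        (1 - (Q ^ (m + 1))⁻¹) * qPochhammer (Q ^ m)⁻¹ Q j := by
      rw [qPochhammer_succ']
      congr 2
      rw [pow_succ]; field_simp
    have h3 : qPochhammer (a * Q ^ (m + 1)) Q (j + 1) * (1 - a * Q ^ (m + j + 2)) =
        (1 - a * Q ^ (m + 1)) * (1 - a * Q ^ (m + 2)) * qPochhammer (a * Q ^ (m + 3)) Q j := by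
      have := qPochhammer_succ (a * Q ^ (m + 1)) Q (j + 1)
      rw [qPochhammer_succ', qPochhammer_succ'] at this
      rw [show a * Q ^ (m + j + 2) = a * Q ^ (m + 1) * Q ^ (j + 1) by ring, ← this]
      ring_nf
    have h4 : qPochhammer (a * Q ^ (m + 2)) Q (j + 1) =
        (1 - a * Q ^ (m + 2)) * qPochhammer (a * Q ^ (m + 3)) Q j := by
      rw [qPochhammer_succ']; ring_nf
    have p1 : qPochhammer (a * Q ^ (m + 3)) Q j ≠ 0 := qPochhammer_ne_zero fun i _ => by
      rw [mul_assoc, ← pow_add]; exact ha' _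
    have h3' : qPochhammer (a * Q ^ (m + 1)) Q (j + 1) =
        (1 - a * Q ^ (m + 1)) * (1 - a * Q ^ (m + 2)) * qPochhammer (a * Q ^ (m + 3)) Q j /
          (1 - a * Q ^ (m + j + 2)) := by
      rw [← h3]; field_simp
    have key : (1 - (Q ^ (m + 1))⁻¹) * (1 - a * Q ^ (m + 1)) * Q ^ (j + 1) -
        (1 - (Q ^ m)⁻¹ * Q ^ j) * (1 - a * Q ^ (m + j + 2)) =
        - ((1 - Q * Q ^ j) * (1 - a * Q ^ (j + 1))) := by
      field_simp; ring
    rw [e4, h2, h3', h4, qPochhammer_succ, neg_div', ← key]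
    generalize qPochhammer (a * Q ^ (m + 3)) Q j = P1 at *
    generalize (1 - (Q ^ (m + 1))⁻¹) = X1 at *
    generalize (1 - (Q ^ m)⁻¹ * Q ^ j) = X2 at *
    generalize 1 - a * Q ^ (m + j + 2) = X3 at *
    generalize 1 - a * Q ^ (m + 1) = X4 at *
    generalize 1 - a * Q ^ (m + 2) = X5 at *
    generalize Q ^ (j + 1) = X6 at *
    field_simp
  have e3 : a * Q ^ 2 * Q ^ (m + 1) / (b * Q * (c * Q)) = a * Q ^ (m + 1) / (b * c) := by
    rw [show b * Q * (c * Q) = b * c * Q ^ 2 by ring,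
      show a * Q ^ 2 * Q ^ (m + 1) = a * Q ^ (m + 1) * Q ^ 2 by ring,
      mul_div_mul_right _ _ (pow_ne_zero 2 hQ0)]
  have e5 : a * Q ^ (m + 1 + 1) / (b * c) = a * Q ^ (m + 1) / (b * c) * Q := by ring
  simp only [sixPhiFiveTerm]
  rw [e3, e5, hwp b, hwp c, mul_pow _ Q]
  generalize (1 - a * Q ^ (2 * (j + 1))) / (1 - a) *
    (qPochhammer a Q (j + 1) / qPochhammer Q Q (j + 1)) = E at *
  generalize (1 - a * Q ^ 2 * Q ^ (2 * j)) / (1 - a * Q ^ 2) *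
    (qPochhammer (a * Q ^ 2) Q j / qPochhammer Q Q j) = E' at *
  generalize qPochhammer (b * Q) Q j / qPochhammer (a * Q ^ 2 * Q / (b * Q)) Q j = B
  generalize qPochhammer (c * Q) Q j / qPochhammer (a * Q ^ 2 * Q / (c * Q)) Q j = C
  generalize qPochhammer (Q ^ (m + 1))⁻¹ Q (j + 1) / qPochhammer (a * Q ^ (m + 1 + 1)) Q (j + 1) =
    M₁ at *
  generalize qPochhammer (Q ^ m)⁻¹ Q (j + 1) / qPochhammer (a * Q ^ (m + 1)) Q (j + 1) = M₀ at *
  generalize qPochhammer (Q ^ m)⁻¹ Q j / qPochhammer (a * Q ^ 2 * Q ^ (m + 1)) Q j = M' at *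
  generalize a * Q ^ (m + 1) / (b * c) = z
  generalize 1 - a * Q / b = β
  generalize 1 - a * Q / c = γ
  generalize 1 - a * Q ^ (m + 1) = u at *
  generalize 1 - a * Q ^ (m + 2) = v at *
  generalize 1 - a * Q ^ (j + 1) = x at *
  generalize 1 - Q * Q ^ j = y at *
  generalize Q ^ (j + 1) = w at *
  linear_combination E * ((1 - b) / β * B) * ((1 - c) / γ * C) * z ^ (j + 1) * hlast -
    ((1 - b) / β * B) * ((1 - c) / γ * C) * z ^ (j + 1) / (u * v) * M' * hlead

/-- The terminating very-well-poised `₆φ₅` summation. -/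
theorem sum_sixPhiFiveTerm (hQ0 : Q ≠ 0) (hQ : ∀ k, 1 - Q * Q ^ k ≠ 0) (m : ℕ) {a b c : F}
    (hb : b ≠ 0) (hc : c ≠ 0) (ha' : ∀ k, 1 - a * Q ^ k ≠ 0)
    (hb' : ∀ k, 1 - a * Q / b * Q ^ k ≠ 0) (hc' : ∀ k, 1 - a * Q / c * Q ^ k ≠ 0) :
    ∑ k ∈ range (m + 1), sixPhiFiveTerm Q a b c m k =
      qPochhammer (a * Q) Q m * qPochhammer (a * Q / (b * c)) Q m /
        (qPochhammer (a * Q / b) Q m * qPochhammer (a * Q / c) Q m) := by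
  have h0 : ∀ {a b c : F} (m : ℕ), 1 - a ≠ 0 → sixPhiFiveTerm Q a b c m 0 = 1 := fun m h => by
    simp [sixPhiFiveTerm, qPochhammer_zero, div_self h]
  have n5 : 1 - a ≠ 0 := by simpa using ha' 0
  -- The recursion also calls the formula for m at the shifted parameters aQ², bQ, cQ.
  induction m generalizing a b c with
  | zero => simp [h0 0 n5, qPochhammer_zero]
  | succ m ih =>
    have e1 : a * Q ^ 2 * Q / (b * Q) = a * Q / b * Q := by field_simp
    have e2 : a * Q ^ 2 * Q / (c * Q) = a * Q / c * Q := by field_simp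
    have e3 : a * Q ^ 2 * Q / (b * Q * (c * Q)) = a * Q / (b * c) := by field_simp
    have a'' : ∀ k, 1 - a * Q ^ 2 * Q ^ k ≠ 0 := fun k => by
      rw [mul_assoc, ← pow_add]; exact ha' _
    have ih1 := ih hb hc ha' hb' hc' n5
    have ih2 := ih (a := a * Q ^ 2) (b := b * Q) (c := c * Q) (mul_ne_zero hb hQ0)
      (mul_ne_zero hc hQ0) a''
      (fun k => by rw [e1, mul_assoc, ← pow_succ']; exact hb' _)
      (fun k => by rw [e2, mul_assoc, ← pow_succ']; exact hc' _) (ha' 2)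
    -- The series for m ends by itself at k = m, so one more term may be included.
    have hlast : sixPhiFiveTerm Q a b c m (m + 1) = 0 := by
      have : qPochhammer (Q ^ m)⁻¹ Q (m + 1) = 0 := by
        rw [qPochhammer_succ, inv_mul_cancel₀ (pow_ne_zero _ hQ0)]; simp
      simp [sixPhiFiveTerm, this]
    have hsum : ∑ k ∈ range (m + 1 + 1), sixPhiFiveTerm Q a b c (m + 1) k =
        ∑ k ∈ range (m + 1), sixPhiFiveTerm Q a b c m k +
        ∑ j ∈ range (m + 1), (sixPhiFiveTerm Q a b c (m + 1) (j + 1) -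
          sixPhiFiveTerm Q a b c m (j + 1)) := by
      rw [sum_range_succ', h0 _ n5, sum_sub_distrib,
        ← add_zero (∑ k ∈ range (m + 1), sixPhiFiveTerm Q a b c m k), ← hlast,
        ← sum_range_succ (sixPhiFiveTerm Q a b c m), sum_range_succ' (sixPhiFiveTerm Q a b c m),
        h0 _ n5]
      ring
    simp only [sixPhiFiveTerm_succ_sub hQ0 hQ ha', ← mul_sum] at hsum
    rw [hsum, ih1, ih2, e1, e2, e3]
    have h1 : (1 - a * Q) * (1 - a * Q ^ 2) * qPochhammer (a * Q ^ 2 * Q) Q m =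
        qPochhammer (a * Q) Q m * (1 - a * Q ^ (m + 1)) * (1 - a * Q ^ (m + 2)) := by
      have := qPochhammer_succ (a * Q) Q (m + 1)
      rw [qPochhammer_succ', qPochhammer_succ', qPochhammer_succ] at this
      convert this using 1
      · ring_nf
      · ring
    have h2 : ∀ x, (∀ k, 1 - a * Q / x * Q ^ k ≠ 0) →
        qPochhammer (a * Q / x) Q m * (1 - a * Q / x * Q ^ m) / (1 - a * Q / x) =
        qPochhammer (a * Q / x * Q) Q m := fun x hx => by
      rw [← qPochhammer_succ, qPochhammer_succ', mul_div_cancel_left₀]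
      simpa using hx 0
    have p1 : qPochhammer (a * Q / b) Q m ≠ 0 := qPochhammer_ne_zero fun i _ => hb' i
    have p2 : qPochhammer (a * Q / c) Q m ≠ 0 := qPochhammer_ne_zero fun i _ => hc' i
    have n1 := ha' (m + 1)
    have n2 := ha' (m + 2)
    have n3 := hb' m
    have n4 := hc' m
    have n7 : 1 - a * Q / b ≠ 0 := by simpa using hb' 0
    have n8 : 1 - a * Q / c ≠ 0 := by simpa using hc' 0
    rw [← h2 b hb', ← h2 c hc', qPochhammer_succ (a * Q), qPochhammer_succ (a * Q / (b * c)),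
      qPochhammer_succ (a * Q / b), qPochhammer_succ (a * Q / c)]
    rw [show a * Q * Q ^ m = a * Q ^ (m + 1) by ring]
    -- After cancelling common factors, this is all that the inductive step amounts to.
    have key : (1 - a * Q ^ (m + 1)) * (1 - a * Q / (b * c) * Q ^ m) =
      (1 - a * Q / b * Q ^ m) * (1 - a * Q / c * Q ^ m) -
        (1 - b) * (1 - c) * (a * Q ^ (m + 1) / (b * c)) := by
      field_simp; ring
    generalize qPochhammer (a * Q ^ 2 * Q) Q m = P0 at *
    generalize qPochhammer (a * Q) Q m = P1 at *
    generalize qPochhammer (a * Q / b) Q m = P2 at *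
    generalize qPochhammer (a * Q / c) Q m = P3 at *
    generalize qPochhammer (a * Q / (b * c)) Q m = P4 at *
    generalize (1 - a * Q / b * Q ^ m) = X1 at *
    generalize (1 - a * Q / c * Q ^ m) = X2 at *
    generalize 1 - a * Q / b = X3 at *
    generalize 1 - a * Q / c = X4 at *
    generalize a * Q ^ (m + 1) / (b * c) = X6 at *
    generalize 1 - a * Q ^ (m + 1) = X7 at *
    generalize 1 - a * Q ^ (m + 2) = X8 at *
    generalize (1 - a * Q / (b * c) * Q ^ m) = X9 at *
    trans P1 * P4 * (X7 * X9) / (P2 * X1 * (P3 * X2))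
    · rw [key]
      generalize 1 - a * Q = X10 at *
      generalize 1 - a * Q ^ 2 = X11 at *
      trans P1 * P4 / (P2 * P3) - (X10 * X11 * P0) * P4 * (1 - b) * (1 - c) * X6 /
        (X7 * X8 * P2 * X1 * P3 * X2)
      · field_simp; ring
      · rw [h1]; field_simp
    · ring

end SixPhiFive

/-! ### Exact evaluation at a = q^(±2n). -/

/-- The `k`-th summand of the truncated basic hypergeometric sum. -/
def truncatedTerm {F : Type*} [Field F] (q a : F) (k : ℕ) : F :=
  qInteger (q ^ 2) (8 * (k : ℤ) + 1) * qInteger q (8 * (k : ℤ) + 1) ^ 2 *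
    ((qPochhammer (q ^ 2) (q ^ 8) k ^ 2 * qPochhammer (a * q ^ 2) (q ^ 8) k *
        qPochhammer (q ^ 2 / a) (q ^ 8) k) /
      (qPochhammer (q ^ 8) (q ^ 8) k ^ 2 * qPochhammer (a * q ^ 8) (q ^ 8) k *
        qPochhammer (q ^ 8 / a) (q ^ 8) k)) *
    q ^ (-(4 * (k : ℤ)))

/-- The closed form of the sum over `k ≤ m`, where `n = 4 m + 1`. -/
def closedForm {F : Type*} [Field F] (q a : F) (m : ℕ) : F :=
  qInteger (q ^ 2) ((4 * m + 1 : ℕ) : ℤ) *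
    (qPochhammer (q ^ 4) (q ^ 8) m / qPochhammer (q ^ 8) (q ^ 8) m) * (q ^ (2 * m))⁻¹ *
    (1 - ((1 - a * q ^ 2) * (1 - q ^ 2 / a)) / ((1 - q) ^ 2 * (1 + q ^ 2)))

section ClosedForm

variable {F : Type*} [Field F]

lemma qInteger_natCast (q : F) (m : ℕ) : qInteger q (m : ℤ) = (1 - q ^ m) / (1 - q) := by
  rw [qInteger, zpow_natCast]

lemma truncatedTerm_eq (q a : F) (k : ℕ) : truncatedTerm q a k =
    (1 - (q ^ 2) ^ (8 * k + 1)) / (1 - q ^ 2) * ((1 - q ^ (8 * k + 1)) / (1 - q)) ^ 2 *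
    ((qPochhammer (q ^ 2) (q ^ 8) k ^ 2 * qPochhammer (a * q ^ 2) (q ^ 8) k *
        qPochhammer (q ^ 2 / a) (q ^ 8) k) /
      (qPochhammer (q ^ 8) (q ^ 8) k ^ 2 * qPochhammer (a * q ^ 8) (q ^ 8) k *
        qPochhammer (q ^ 8 / a) (q ^ 8) k)) *
    (q ^ (4 * k))⁻¹ := by
  rw [truncatedTerm, show (8 * (k : ℤ) + 1) = ((8 * k + 1 : ℕ) : ℤ) by push_cast; ring,
    qInteger_natCast, qInteger_natCast, zpow_neg,
    show (4 * (k : ℤ)) = ((4 * k : ℕ) : ℤ) by push_cast; ring, zpow_natCast]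

lemma truncatedTerm_inv (q a : F) (k : ℕ) : truncatedTerm q a⁻¹ k = truncatedTerm q a k := by
  simp only [truncatedTerm, div_inv_eq_mul, inv_mul_eq_div, mul_comm _ a]
  rw [mul_right_comm (qPochhammer (q ^ 2) (q ^ 8) k ^ 2),
    mul_right_comm (qPochhammer (q ^ 8) (q ^ 8) k ^ 2)]

lemma closedForm_inv (q a : F) (m : ℕ) : closedForm q a⁻¹ m = closedForm q a m := by
  simp only [closedForm, div_inv_eq_mul, inv_mul_eq_div, mul_comm _ a]
  rw [mul_comm (1 - q ^ 2 / a)]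

/-- The factors on the left are 1 - 1/(u Q^i) = -(1 - u Q^i)/(u Q^i) for i < m, in reverse order. -/
lemma qPochhammer_reverse {Q u : F} (hQ : Q ≠ 0) (hu : u ≠ 0) (m : ℕ) :
    qPochhammer (Q / (u * Q ^ m)) Q m * (u ^ m * ∏ i ∈ range m, Q ^ i) =
      (-1) ^ m * qPochhammer u Q m := by
  induction m with
  | zero => simp [qPochhammer_zero]
  | succ m ih =>
    rw [qPochhammer_succ', qPochhammer_succ, prod_range_succ,
      show Q / (u * Q ^ (m + 1)) * Q = Q / (u * Q ^ m) by field_simp; ring]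
    have : (1 - Q / (u * Q ^ (m + 1))) * (u * Q ^ m) = -(1 - u * Q ^ m) := by
      field_simp; ring
    linear_combination (1 - Q / (u * Q ^ (m + 1))) * (u * Q ^ m) * ih +
      (-1) ^ m * qPochhammer u Q m * this

lemma sum_truncatedTerm_aux {q : F} (hq0 : q ≠ 0) (hq : ∀ k, q ^ (k + 1) ≠ 1) (m : ℕ) :
    ∑ k ∈ range (m + 1), truncatedTerm q (q ^ (8 * m + 2)) k =
      closedForm q (q ^ (8 * m + 2)) m := by
  have hlt : ∀ i j, i < j → q ^ i ≠ q ^ j := fun i j h e => by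
    obtain ⟨d, rfl⟩ := Nat.exists_eq_add_of_lt h
    rw [add_assoc, pow_add] at e
    exact hq d (mul_left_cancel₀ (pow_ne_zero i hq0) (by rw [← e, mul_one]))
  have hne : ∀ i j, i ≠ j → q ^ i ≠ q ^ j := fun i j h =>
    h.lt_or_gt.elim (hlt i j) fun h => (hlt j i h).symm
  have h1 : ∀ j, j ≠ 0 → 1 - q ^ j ≠ 0 := fun j h => by
    rw [sub_ne_zero, ← pow_zero q]; exact hne _ _ h.symm
  have h2 : ∀ i j, i ≠ j → 1 - q ^ i / q ^ j ≠ 0 := fun i j h => by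
    rw [sub_ne_zero, ne_comm, Ne, div_eq_one_iff_eq (pow_ne_zero _ hq0)]
    exact hne _ _ h
  have hQ0 : q ^ 8 ≠ 0 := pow_ne_zero _ hq0
  have hp0 : q ^ 2 ≠ 0 := pow_ne_zero _ hq0
  have hQ : ∀ k, 1 - q ^ 8 * (q ^ 8) ^ k ≠ 0 := fun k => by
    rw [← pow_mul, ← pow_add]; exact h1 _ (by omega)
  have ha : ∀ k, 1 - q ^ 2 * (q ^ 8) ^ k ≠ 0 := fun k => by
    rw [← pow_mul, ← pow_add]; exact h1 _ (by omega)
  have hb : ∀ k, 1 - q ^ 2 * q ^ 8 / q ^ 2 * (q ^ 8) ^ k ≠ 0 := fun k => by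
    rw [mul_div_cancel_left₀ _ hp0]; exact hQ k
  set c : F := q ^ (8 * m + 4) with hc
  have hc0 : c ≠ 0 := pow_ne_zero _ hq0
  have hcQ : ∀ k, 1 - q ^ 2 * q ^ 8 / c * (q ^ 8) ^ k ≠ 0 := fun k => by
    rw [← pow_mul, ← pow_add, div_mul_eq_mul_div, ← pow_add, hc]; exact h2 _ _ (by omega)
  have hcQ' : ∀ k, 1 - q ^ 2 * q ^ 8 / (c * q ^ 8) * (q ^ 8) ^ k ≠ 0 := fun k => by
    rw [mul_div_mul_right _ _ hQ0, ← pow_mul, div_mul_eq_mul_div, ← pow_add, hc]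
    exact h2 _ _ (by omega)
  have S₁ := sum_sixPhiFiveTerm hQ0 hQ m hp0 hc0 ha hb hcQ
  have S₂ := sum_sixPhiFiveTerm hQ0 hQ m hp0 (mul_ne_zero hc0 hQ0) ha hb hcQ'
  have n1 : 1 - q ≠ 0 := by simpa using h1 1 one_ne_zero
  have n2 : 1 - q ^ 2 ≠ 0 := h1 2 two_ne_zero
  have n3 : 1 + q ^ 2 ≠ 0 := fun h => h1 4 (by norm_num) (by linear_combination (1 - q ^ 2) * h)
  have n4 : 1 - q ^ 2 / c ≠ 0 := h2 _ _ (by omega)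
  have n5 : 1 - c ≠ 0 := h1 _ (by omega)
  -- The ₆φ₅ has a = b = q², base q^8 and c = q^(8m+4), hence argument q^4. The extra factor is (1 -
  -- q^(8k+1))² q^(-8k), expanded.
  have hmain : ∀ k, truncatedTerm q (q ^ (8 * m + 2)) k =
      sixPhiFiveTerm (q ^ 8) (q ^ 2) (q ^ 2) c m k *
        (((q ^ 8) ^ k)⁻¹ + q ^ 2 * (q ^ 8) ^ k - 2 * q) / (1 - q) ^ 2 := fun k => by
    rw [truncatedTerm_eq, sixPhiFiveTerm]
    have e1 : q ^ (8 * m + 2) * q ^ 2 = c := by rw [hc]; ring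
    have e2 : q ^ 2 / q ^ (8 * m + 2) = ((q ^ 8) ^ m)⁻¹ := by
      rw [← pow_mul, pow_add]; field_simp
    have e3 : q ^ (8 * m + 2) * q ^ 8 = q ^ 2 * (q ^ 8) ^ (m + 1) := by ring
    have e4 : q ^ 8 / q ^ (8 * m + 2) = q ^ 2 * q ^ 8 / c := by
      rw [hc, pow_add, pow_add]; field_simp
    have e5 : q ^ 2 * (q ^ 8) ^ (m + 1) / (q ^ 2 * c) = q ^ 4 := by
      rw [hc, mul_div_mul_left _ _ hp0, ← pow_mul, mul_add, pow_add, pow_add]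
      field_simp
    have e6 : q ^ 2 * q ^ 8 / q ^ 2 = q ^ 8 := mul_div_cancel_left₀ _ hp0
    have e7 : (1 - q ^ (8 * k + 1)) ^ 2 * (q ^ (4 * k))⁻¹ =
        (q ^ 4) ^ k * (((q ^ 8) ^ k)⁻¹ + q ^ 2 * (q ^ 8) ^ k - 2 * q) := by
      have : q ^ (4 * k) ≠ 0 := pow_ne_zero _ hq0
      rw [← pow_mul, ← pow_mul, show 8 * k = 4 * k + 4 * k by ring, pow_succ, pow_add]
      field_simp
      ring
    have e8 : (q ^ 2) ^ (8 * k + 1) = q ^ 2 * (q ^ 8) ^ (2 * k) := by ring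
    rw [e1, e2, e3, e4, e5, e6, e8]
    trans (1 - q ^ 2 * (q ^ 8) ^ (2 * k)) / (1 - q ^ 2) * (qPochhammer (q ^ 2) (q ^ 8) k ^ 2 *
      qPochhammer c (q ^ 8) k * qPochhammer (((q ^ 8) ^ m)⁻¹) (q ^ 8) k /
      (qPochhammer (q ^ 8) (q ^ 8) k ^ 2 * qPochhammer (q ^ 2 * (q ^ 8) ^ (m + 1)) (q ^ 8) k *
        qPochhammer (q ^ 2 * q ^ 8 / c) (q ^ 8) k)) / (1 - q) ^ 2 *
      ((1 - q ^ (8 * k + 1)) ^ 2 * (q ^ (4 * k))⁻¹)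
    · generalize 1 - q = Z
      ring
    · rw [e7]
      generalize 1 - q ^ 2 * (q ^ 8) ^ (2 * k) = X
      generalize 1 - q ^ 2 = Y
      generalize 1 - q = Z
      generalize ((q ^ 8) ^ k)⁻¹ + q ^ 2 * (q ^ 8) ^ k - 2 * q = W
      generalize qPochhammer (q ^ 8) (q ^ 8) k = P₁
      generalize qPochhammer (q ^ 2 * (q ^ 8) ^ (m + 1)) (q ^ 8) k = P₂
      generalize qPochhammer (q ^ 2 * q ^ 8 / c) (q ^ 8) k = P₃
      generalize (q ^ 4) ^ k = P₄
      generalize qPochhammer (((q ^ 8) ^ m)⁻¹) (q ^ 8) k = P₅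
      generalize qPochhammer (q ^ 2) (q ^ 8) k = P₆
      generalize qPochhammer c (q ^ 8) k = P₇
      ring
  -- The bracket equals (1 - c Q^k)(1 - q² Q^k / c) Q^(-k) with Q = q^8, which is what replacing c
  -- by cQ contributes. It differs from the factor in `hmain` by a constant.
  have hshift : ∀ k, sixPhiFiveTerm (q ^ 8) (q ^ 2) (q ^ 2) c m k *
      (((q ^ 8) ^ k)⁻¹ + q ^ 2 * (q ^ 8) ^ k - c - q ^ 2 / c) =
      (1 - c) * (1 - q ^ 2 / c) * sixPhiFiveTerm (q ^ 8) (q ^ 2) (q ^ 2) (c * q ^ 8) m k :=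
      fun k => by
    have e1 : (1 - c) * qPochhammer (c * q ^ 8) (q ^ 8) k =
        qPochhammer c (q ^ 8) k * (1 - c * (q ^ 8) ^ k) := by
      rw [← qPochhammer_succ, qPochhammer_succ']
    have e2 : qPochhammer (q ^ 2 / c) (q ^ 8) k * (1 - q ^ 2 / c * (q ^ 8) ^ k) =
        (1 - q ^ 2 / c) * qPochhammer (q ^ 2 * q ^ 8 / c) (q ^ 8) k := by
      rw [← qPochhammer_succ, qPochhammer_succ', div_mul_eq_mul_div]
    have n6 : 1 - q ^ 2 / c * (q ^ 8) ^ k ≠ 0 := by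
      have := hcQ' k
      rwa [mul_div_mul_right _ _ hQ0] at this
    have p1 : qPochhammer (q ^ 2 * q ^ 8 / c) (q ^ 8) k ≠ 0 :=
      qPochhammer_ne_zero fun i _ => hcQ i
    have e3 : qPochhammer (q ^ 2 / c) (q ^ 8) k = (1 - q ^ 2 / c) *
        qPochhammer (q ^ 2 * q ^ 8 / c) (q ^ 8) k / (1 - q ^ 2 / c * (q ^ 8) ^ k) := by
      rw [← e2, mul_div_cancel_right₀ _ n6]
    have e4 : (1 - c) * (1 - q ^ 2 / c) *
        (qPochhammer (c * q ^ 8) (q ^ 8) k / qPochhammer (q ^ 2 / c) (q ^ 8) k) =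
        qPochhammer c (q ^ 8) k / qPochhammer (q ^ 2 * q ^ 8 / c) (q ^ 8) k *
          ((1 - c * (q ^ 8) ^ k) * (1 - q ^ 2 / c * (q ^ 8) ^ k)) := by
      rw [e3, mul_right_comm, ← mul_div_assoc, e1]
      generalize 1 - q ^ 2 / c * (q ^ 8) ^ k = X at *
      generalize 1 - q ^ 2 / c = Y at *
      generalize 1 - c * (q ^ 8) ^ k = Z at *
      field_simp
    have e5 : (((q ^ 8) ^ k)⁻¹ + q ^ 2 * (q ^ 8) ^ k - c - q ^ 2 / c) =
        (1 - c * (q ^ 8) ^ k) * (1 - q ^ 2 / c * (q ^ 8) ^ k) * ((q ^ 8) ^ k)⁻¹ := by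
      have : (q ^ 8) ^ k ≠ 0 := pow_ne_zero _ hQ0
      generalize (q ^ 8) ^ k = X at *
      field_simp
      ring
    have e6 : q ^ 2 * (q ^ 8) ^ (m + 1) / (q ^ 2 * (c * q ^ 8)) =
        q ^ 2 * (q ^ 8) ^ (m + 1) / (q ^ 2 * c) * (q ^ 8)⁻¹ := by
      rw [← mul_assoc, ← div_div, div_eq_mul_inv _ (q ^ 8)]
    simp only [sixPhiFiveTerm]
    rw [e5, e6, mul_div_mul_right _ _ hQ0, mul_pow _ (q ^ 8)⁻¹, inv_pow (q ^ 8)]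
    generalize (1 - q ^ 2 * (q ^ 8) ^ (2 * k)) / (1 - q ^ 2) *
      (qPochhammer (q ^ 2) (q ^ 8) k / qPochhammer (q ^ 8) (q ^ 8) k) = E
    generalize qPochhammer (q ^ 2) (q ^ 8) k / qPochhammer (q ^ 2 * q ^ 8 / q ^ 2) (q ^ 8) k = B
    generalize qPochhammer ((q ^ 8) ^ m)⁻¹ (q ^ 8) k /
      qPochhammer (q ^ 2 * (q ^ 8) ^ (m + 1)) (q ^ 8) k = G
    generalize (q ^ 2 * (q ^ 8) ^ (m + 1) / (q ^ 2 * c)) ^ k = Z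
    generalize ((q ^ 8) ^ k)⁻¹ = Y
    linear_combination -(E * B * G * Z * Y) * e4
  have hsum : ∑ k ∈ range (m + 1), truncatedTerm q (q ^ (8 * m + 2)) k =
      ((1 - c) * (1 - q ^ 2 / c) *
        ∑ k ∈ range (m + 1), sixPhiFiveTerm (q ^ 8) (q ^ 2) (q ^ 2) (c * q ^ 8) m k +
      (c + q ^ 2 / c - 2 * q) *
        ∑ k ∈ range (m + 1), sixPhiFiveTerm (q ^ 8) (q ^ 2) (q ^ 2) c m k) / (1 - q) ^ 2 := by
    rw [mul_sum, mul_sum, ← sum_add_distrib, sum_div]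
    refine sum_congr rfl fun k _ => ?_
    rw [hmain, ← hshift]
    ring
  rw [hsum, S₁, S₂, mul_div_cancel_left₀ _ hp0, mul_div_mul_left _ _ hp0,
    mul_div_mul_left _ _ hp0, mul_div_mul_right _ _ hQ0, div_mul_cancel_right₀ hQ0]
  -- Here c = q^4 Q^m with Q = q^8, so the final factors at 1/c and q²/c are 1 - q^(-4) and 1 -
  -- q^(-2); their ratio is the source of 1 + q².
  have r1 : (1 - c⁻¹) * qPochhammer (q ^ 8 / c) (q ^ 8) m =
      qPochhammer c⁻¹ (q ^ 8) m * (1 - (q ^ 4)⁻¹) := by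
    rw [div_eq_inv_mul, ← qPochhammer_succ', qPochhammer_succ]
    congr 2
    rw [hc, pow_add, ← pow_mul]; field_simp
  have r2 : (1 - q ^ 2 / c) * qPochhammer (q ^ 2 * q ^ 8 / c) (q ^ 8) m =
      qPochhammer (q ^ 2 / c) (q ^ 8) m * (1 - (q ^ 2)⁻¹) := by
    rw [mul_div_right_comm, ← qPochhammer_succ', qPochhammer_succ]
    congr 2
    rw [hc, pow_add, ← pow_mul]; field_simp
  have r3 : (1 - q ^ 2) * qPochhammer (q ^ 2 * q ^ 8) (q ^ 8) m =
      qPochhammer (q ^ 2) (q ^ 8) m * (1 - (q ^ 2) ^ (4 * m + 1)) := by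
    rw [← qPochhammer_succ', qPochhammer_succ]
    congr 2
    ring
  have r4 := qPochhammer_reverse hQ0 (pow_ne_zero 4 hq0) m
  have r5 := qPochhammer_reverse hQ0 hp0 m
  rw [show q ^ 4 * (q ^ 8) ^ m = c by rw [hc]; ring] at r4
  rw [show q ^ 8 / (q ^ 2 * (q ^ 8) ^ m) = q ^ 2 * q ^ 8 / c by
    rw [hc, ← pow_mul, pow_add]; field_simp] at r5
  have p1 : qPochhammer (q ^ 2 * q ^ 8 / c) (q ^ 8) m ≠ 0 := qPochhammer_ne_zero fun i _ => hcQ i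
  have p2 : qPochhammer (q ^ 8) (q ^ 8) m ≠ 0 := qPochhammer_ne_zero fun i _ => hQ i
  have p3 : qPochhammer (q ^ 2) (q ^ 8) m ≠ 0 := qPochhammer_ne_zero fun i _ => ha i
  have p4 : qPochhammer (q ^ 2 / c) (q ^ 8) m ≠ 0 := qPochhammer_ne_zero fun i _ => by
    have := hcQ' i
    rwa [mul_div_mul_right _ _ hQ0] at this
  have hG : ∏ i ∈ range m, (q ^ 8) ^ i ≠ 0 :=
    prod_ne_zero_iff.2 fun i _ => pow_ne_zero _ hQ0
  have hratio : qPochhammer (q ^ 8 / c) (q ^ 8) m / qPochhammer (q ^ 2 * q ^ 8 / c) (q ^ 8) m =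
      qPochhammer (q ^ 4) (q ^ 8) m / qPochhammer (q ^ 2) (q ^ 8) m * (q ^ (2 * m))⁻¹ := by
    rw [div_eq_iff p1]
    have hpm : (q ^ 2) ^ m ≠ 0 := pow_ne_zero _ hp0
    apply mul_right_cancel₀ (mul_ne_zero (pow_ne_zero m (pow_ne_zero 4 hq0)) hG)
    rw [r4, show (q ^ 4) ^ m = (q ^ 2) ^ m * (q ^ 2) ^ m by ring, pow_mul q 2 m]
    trans qPochhammer (q ^ 4) (q ^ 8) m / qPochhammer (q ^ 2) (q ^ 8) m *
      (qPochhammer (q ^ 2 * q ^ 8 / c) (q ^ 8) m *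
        ((q ^ 2) ^ m * ∏ i ∈ range m, (q ^ 8) ^ i))
    · rw [r5]; field_simp
    · field_simp
  have hratio' : (1 - c) * (1 - q ^ 2 / c) *
      (qPochhammer c⁻¹ (q ^ 8) m / qPochhammer (q ^ 2 / c) (q ^ 8) m) =
      -(q ^ 2 * (1 - c) ^ 2 / ((1 + q ^ 2) * c)) *
      (qPochhammer (q ^ 8 / c) (q ^ 8) m / qPochhammer (q ^ 2 * q ^ 8 / c) (q ^ 8) m) := by
    have n6 : 1 - (q ^ 4)⁻¹ ≠ 0 := by simpa using h2 0 4 (by norm_num)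
    have n7 : 1 - (q ^ 2)⁻¹ ≠ 0 := by simpa using h2 0 2 (by norm_num)
    have r1' : qPochhammer c⁻¹ (q ^ 8) m =
      (1 - c⁻¹) * qPochhammer (q ^ 8 / c) (q ^ 8) m / (1 - (q ^ 4)⁻¹) := by
      rw [r1, mul_div_cancel_right₀ _ n6]
    have r2' : qPochhammer (q ^ 2 / c) (q ^ 8) m =
      (1 - q ^ 2 / c) * qPochhammer (q ^ 2 * q ^ 8 / c) (q ^ 8) m / (1 - (q ^ 2)⁻¹) := by
      rw [r2, mul_div_cancel_right₀ _ n7]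
    have e : (1 - c) * (1 - c⁻¹) * (1 - (q ^ 2)⁻¹) / (1 - (q ^ 4)⁻¹) =
        -(q ^ 2 * (1 - c) ^ 2 / ((1 + q ^ 2) * c)) := by
      have n8 : q ^ 2 - 1 ≠ 0 := by rw [← neg_sub]; exact neg_ne_zero.2 n2
      rw [show 1 - (q ^ 4)⁻¹ = (1 - (q ^ 2)⁻¹) * ((1 + q ^ 2) / q ^ 2) by field_simp; ring,
        show 1 - c⁻¹ = -(1 - c) / c by field_simp; ring]
      field_simp
    rw [r1', r2', ← e]
    generalize 1 - q ^ 2 / c = X at *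
    generalize 1 - (q ^ 4)⁻¹ = Y at *
    generalize 1 - (q ^ 2)⁻¹ = Z at *
    field_simp
  have r3' : qPochhammer (q ^ 2 * q ^ 8) (q ^ 8) m =
      qPochhammer (q ^ 2) (q ^ 8) m * (1 - (q ^ 2) ^ (4 * m + 1)) / (1 - q ^ 2) := by
    rw [← r3, mul_div_cancel_left₀ _ n2]
  trans qPochhammer (q ^ 2 * q ^ 8) (q ^ 8) m / qPochhammer (q ^ 8) (q ^ 8) m *
    ((1 - c) * (1 - q ^ 2 / c) *
      (qPochhammer c⁻¹ (q ^ 8) m / qPochhammer (q ^ 2 / c) (q ^ 8) m) +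
    (c + q ^ 2 / c - 2 * q) *
      (qPochhammer (q ^ 8 / c) (q ^ 8) m / qPochhammer (q ^ 2 * q ^ 8 / c) (q ^ 8) m)) /
      (1 - q) ^ 2
  · generalize 1 - q ^ 2 / c = X
    generalize c + q ^ 2 / c - 2 * q = Y
    generalize 1 - c = Z
    generalize 1 - q = W
    ring
  rw [hratio', hratio, r3', closedForm, qInteger_natCast,
    show q ^ (8 * m + 2) * q ^ 2 = c by rw [hc]; ring,
    show q ^ 2 / q ^ (8 * m + 2) = q ^ 4 / c by rw [hc, pow_add, pow_add]; field_simp]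
  have key : (-(q ^ 2 * (1 - c) ^ 2 / ((1 + q ^ 2) * c)) + (c + q ^ 2 / c - 2 * q)) =
      (1 - q) ^ 2 * (1 - (1 - c) * (1 - q ^ 4 / c) / ((1 - q) ^ 2 * (1 + q ^ 2))) := by
    field_simp
    ring
  generalize (1 - (1 - c) * (1 - q ^ 4 / c) / ((1 - q) ^ 2 * (1 + q ^ 2))) = X at *
  rw [← add_mul, key]
  generalize 1 - (q ^ 2) ^ (4 * m + 1) = Y
  generalize 1 - q ^ 2 = W at *
  generalize (q ^ (2 * m))⁻¹ = Z
  field_simp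

/-- The exact evaluation of the sum at the two specializations `a = q ^ (2 n)` and
`a = q ^ (-2 n)` with `n = 4 m + 1`. -/
theorem sum_truncatedTerm {q a : F} (hq0 : q ≠ 0) (hq : ∀ k, q ^ (k + 1) ≠ 1) (m : ℕ)
    (ha : a = q ^ (8 * m + 2) ∨ a * q ^ (8 * m + 2) = 1) :
    ∑ k ∈ range (m + 1), truncatedTerm q a k = closedForm q a m := by
  rcases ha with rfl | ha
  · exact sum_truncatedTerm_aux hq0 hq m
  · rw [← inv_inv a, inv_eq_of_mul_eq_one_right ha]
    simp only [truncatedTerm_inv, closedForm_inv]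
    exact sum_truncatedTerm_aux hq0 hq m

end ClosedForm

/-! ### Antisymmetry of the summands at a root of unity. -/

section RootOfUnity

variable {F : Type*} [Field F]

/-- Since p^(4M+1) = 1, the factor at p^(4k+1) meets one at the inverse power p^(4(M-k)). Pairing x
with 1/x cancels the powers of x, by (1 - xv)(1 - v/x) = v²(1 - x/v)(1 - 1/(xv)). -/
lemma qPochhammer_reflect {Q p x : F} (hx : x ≠ 0) {M : ℕ} (hp : Q = p ^ 4)
    (hpM : p ^ (4 * M + 1) = 1) {k : ℕ} (hk : k ≤ M) :
    qPochhammer (x * p) Q k * qPochhammer (p / x) Q k *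
      (qPochhammer (x * Q) Q (M - k) * qPochhammer (Q / x) Q (M - k)) * p ^ (2 * k) =
      p ^ (4 * k ^ 2) * (qPochhammer (x * Q) Q M * qPochhammer (Q / x) Q M) := by
  induction k with
  | zero => simp [qPochhammer_zero]
  | succ k ih =>
    obtain ⟨N, rfl⟩ := Nat.exists_eq_add_of_le hk
    have ih := ih (by omega)
    rw [show k + 1 + N - k = N + 1 by omega] at ih
    rw [show k + 1 + N - (k + 1) = N by omega]
    simp only [qPochhammer_succ _ _ N, qPochhammer_succ _ _ k] at ih ⊢
    rw [show p ^ (4 * (k + 1) ^ 2) = p ^ (8 * k + 4) * p ^ (4 * k ^ 2) by ring,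
      mul_assoc (p ^ (8 * k + 4)), ← ih]
    have e : p ^ (4 * N + 4) * p ^ (4 * k + 1) = 1 := by rw [← hpM]; ring
    have h1 : x * Q * Q ^ N = x * p ^ (4 * N + 4) := by rw [hp]; ring
    have h2 : Q / x * Q ^ N = p ^ (4 * N + 4) / x := by rw [hp]; ring
    have h3 : x * p * Q ^ k = x * p ^ (4 * k + 1) := by rw [hp]; ring
    have h4 : p / x * Q ^ k = p ^ (4 * k + 1) / x := by rw [hp]; ring
    have key : (1 - x * p ^ (4 * k + 1)) * (1 - p ^ (4 * k + 1) / x) =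
        (p ^ (4 * k + 1)) ^ 2 * ((1 - x * p ^ (4 * N + 4)) * (1 - p ^ (4 * N + 4) / x)) := by
      rw [eq_inv_of_mul_eq_one_left e]
      have hv : p ^ (4 * k + 1) ≠ 0 := right_ne_zero_of_mul_eq_one e
      generalize p ^ (4 * k + 1) = v at *
      field_simp
      ring
    rw [h1, h2, h3, h4]
    rw [show (p ^ (4 * k + 1)) ^ 2 = p ^ (8 * k + 2) by ring] at key
    linear_combination qPochhammer (x * p) Q k * qPochhammer (p / x) Q k *
      (qPochhammer (x * Q) Q N * qPochhammer (Q / x) Q N) * p ^ (2 * k + 2) * key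

variable {ζ α : F} {M : ℕ}

/-- Put x = ζ^(8k+1). Passing to M - k inverts x and multiplies (1 - x²)(1 - x)² by -x^(-4), while
the remaining power of ζ gains x^4. The other factors are symmetric. -/
lemma truncatedTerm_reflect (hα0 : α ≠ 0) (hζ : ζ ^ (8 * M + 2) = 1)
    (h1 : ∀ i < M, 1 - ζ ^ 8 * (ζ ^ 8) ^ i ≠ 0) (h2 : ∀ i < M, 1 - α * ζ ^ 8 * (ζ ^ 8) ^ i ≠ 0)
    (h3 : ∀ i < M, 1 - ζ ^ 8 / α * (ζ ^ 8) ^ i ≠ 0) {k : ℕ} (hk : k ≤ M) :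
    truncatedTerm ζ α (M - k) = -truncatedTerm ζ α k := by
  have hζ0 : ζ ≠ 0 := by rintro rfl; simp at hζ
  have h8 : ζ ^ 8 = (ζ ^ 2) ^ 4 := by ring
  have hp : (ζ ^ 2) ^ (4 * M + 1) = 1 := by rw [← hζ]; ring
  set S := qPochhammer (ζ ^ 8) (ζ ^ 8) M ^ 2 * qPochhammer (α * ζ ^ 8) (ζ ^ 8) M *
    qPochhammer (ζ ^ 8 / α) (ζ ^ 8) M with hS
  set D : ℕ → F := fun k => qPochhammer (ζ ^ 8) (ζ ^ 8) k ^ 2 * qPochhammer (α * ζ ^ 8) (ζ ^ 8) k *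
    qPochhammer (ζ ^ 8 / α) (ζ ^ 8) k with hD
  have hD0 : ∀ k ≤ M, D k ≠ 0 := fun k hk => mul_ne_zero (mul_ne_zero (pow_ne_zero _
      (qPochhammer_ne_zero fun i hi => h1 i (by omega)))
      (qPochhammer_ne_zero fun i hi => h2 i (by omega)))
      (qPochhammer_ne_zero fun i hi => h3 i (by omega))
  have hnum : ∀ k ≤ M, qPochhammer (ζ ^ 2) (ζ ^ 8) k ^ 2 * qPochhammer (α * ζ ^ 2) (ζ ^ 8) k *
      qPochhammer (ζ ^ 2 / α) (ζ ^ 8) k * D (M - k) * ζ ^ (8 * k) = ζ ^ (16 * k ^ 2) * S := by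
    intro k hk
    have a1 := qPochhammer_reflect (x := 1) one_ne_zero h8 hp hk
    have a2 := qPochhammer_reflect hα0 h8 hp hk
    simp only [one_mul, div_one] at a1
    have e1 : ζ ^ (8 * k) = (ζ ^ 2) ^ (2 * k) * (ζ ^ 2) ^ (2 * k) := by ring
    have e2 : ζ ^ (16 * k ^ 2) = (ζ ^ 2) ^ (4 * k ^ 2) * (ζ ^ 2) ^ (4 * k ^ 2) := by ring
    rw [e1, e2]
    simp only [hD, hS]
    generalize (ζ ^ 2) ^ (2 * k) = P at *
    generalize (ζ ^ 2) ^ (4 * k ^ 2) = P' at *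
    linear_combination (congrArg₂ (· * ·) a1 a2)
  have hval : ∀ k ≤ M, truncatedTerm ζ α k =
      (1 - (ζ ^ (8 * k + 1)) ^ 2) * (1 - ζ ^ (8 * k + 1)) ^ 2 * (ζ ^ (16 * k ^ 2) / ζ ^ (12 * k)) *
      (S / (D k * D (M - k)) / ((1 - ζ ^ 2) * (1 - ζ) ^ 2)) := fun k hk => by
    have hDk := hD0 (M - k) (by omega)
    have e : qPochhammer (ζ ^ 2) (ζ ^ 8) k ^ 2 * qPochhammer (α * ζ ^ 2) (ζ ^ 8) k *
      qPochhammer (ζ ^ 2 / α) (ζ ^ 8) k = ζ ^ (16 * k ^ 2) * S / (D (M - k) * ζ ^ (8 * k)) := by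
      rw [eq_div_iff (mul_ne_zero hDk (pow_ne_zero _ hζ0)), ← mul_assoc, hnum k hk]
    rw [truncatedTerm_eq, e, show (ζ ^ 2) ^ (8 * k + 1) = (ζ ^ (8 * k + 1)) ^ 2 by ring,
      show ζ ^ (12 * k) = ζ ^ (8 * k) * ζ ^ (4 * k) by ring]
    change _ * _ * (_ / D k) * _ = _
    generalize ζ ^ (8 * k + 1) = X
    generalize D k = X1
    generalize D (M - k) = X2
    generalize ζ ^ (8 * k) = X3
    generalize ζ ^ (4 * k) = X4
    generalize ζ ^ (16 * k ^ 2) = X5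
    generalize 1 - ζ = X6
    generalize 1 - ζ ^ 2 = X7
    generalize 1 - X = X8
    generalize 1 - X ^ 2 = X9
    ring
  rw [hval _ hk, hval (M - k) (by omega), Nat.sub_sub_self hk, mul_comm (D (M - k))]
  obtain ⟨j, rfl⟩ := Nat.exists_eq_add_of_le hk
  rw [Nat.add_sub_cancel_left]
  have hxy : ζ ^ (8 * k + 1) * ζ ^ (8 * j + 1) = 1 := by rw [← hζ]; ring
  have hex : ζ ^ (16 * j ^ 2) * ζ ^ (12 * k) =
      (ζ ^ (8 * k + 1)) ^ 4 * (ζ ^ (16 * k ^ 2) * ζ ^ (12 * j)) := by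
    -- This power makes each side ζ^(16k) times a power of ζ^(8M+2) = 1, where M = k + j.
    apply mul_right_cancel₀ (pow_ne_zero (16 * j * k + 4 * j + 4 * k) hζ0)
    trans (ζ ^ (8 * (k + j) + 2)) ^ (2 * j) * ζ ^ (16 * k)
    · ring
    · trans (ζ ^ (8 * (k + j) + 2)) ^ (2 * k) * (ζ ^ (8 * (k + j) + 2)) ^ 2 * ζ ^ (16 * k)
      · rw [hζ]; simp
      · ring
  have hx0 := pow_ne_zero (8 * k + 1) hζ0
  have c1 := pow_ne_zero (12 * k) hζ0
  have c2 := pow_ne_zero (12 * j) hζ0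
  have hy : ζ ^ (8 * j + 1) = (ζ ^ (8 * k + 1))⁻¹ := eq_inv_of_mul_eq_one_right hxy
  rw [← neg_mul]
  congr 1
  have hex' : ζ ^ (16 * j ^ 2) / ζ ^ (12 * j) =
      (ζ ^ (8 * k + 1)) ^ 4 * (ζ ^ (16 * k ^ 2) / ζ ^ (12 * k)) := by
    rw [← mul_div_assoc, div_eq_div_iff c2 c1, hex]; ring
  rw [hex', hy]
  generalize ζ ^ (8 * k + 1) = x at *
  generalize ζ ^ (16 * k ^ 2) / ζ ^ (12 * k) = X
  field_simp
  ring

lemma sum_truncatedTerm_eq_zero [CharZero F] (hα0 : α ≠ 0) (hζ : ζ ^ (8 * M + 2) = 1)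
    (h1 : ∀ i < M, 1 - ζ ^ 8 * (ζ ^ 8) ^ i ≠ 0) (h2 : ∀ i < M, 1 - α * ζ ^ 8 * (ζ ^ 8) ^ i ≠ 0)
    (h3 : ∀ i < M, 1 - ζ ^ 8 / α * (ζ ^ 8) ^ i ≠ 0) :
    ∑ k ∈ range (M + 1), truncatedTerm ζ α k = 0 := by
  rw [← self_eq_neg, ← sum_neg_distrib, ← sum_range_reflect]
  refine sum_congr rfl fun k hk => ?_
  rw [mem_range] at hk
  rw [Nat.add_sub_cancel, truncatedTerm_reflect hα0 hζ h1 h2 h3 (by omega)]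

lemma truncatedTerm_eq_zero (hζ : ζ ^ (8 * M + 2) = 1) {k : ℕ} (hk : M < k) :
    truncatedTerm ζ α k = 0 := by
  have : qPochhammer (ζ ^ 2) (ζ ^ 8) k = 0 :=
    prod_eq_zero (mem_range.2 hk) (by rw [sub_eq_zero, ← hζ]; ring)
  simp [truncatedTerm, this]

end RootOfUnity

/-! ### Blocks of d consecutive summands. -/

/-- In a full set of residues modulo `d`, repeated `l` times, the integers `4 i + e` have exactly
`l` multiples of an odd number `d`. -/
lemma card_filter_dvd_four_mul_add {d : ℕ} (hd : Nat.Coprime 4 d) (hd0 : 0 < d) (e l : ℕ) :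
    #{i ∈ range (l * d) | d ∣ 4 * i + e} = l := by
  obtain ⟨v, hv⟩ : ∃ v, ∀ i, d ∣ 4 * i + e ↔ i ≡ v [MOD d] := by
    obtain ⟨f, hf⟩ : ∃ f, d ∣ f + e := ⟨(d - 1) * e, e, by
      obtain ⟨d, rfl⟩ := Nat.exists_eq_succ_of_ne_zero hd0.ne'
      simp only [Nat.succ_eq_add_one, Nat.add_sub_cancel]; ring⟩
    -- With f ≡ -e, a multiple z = 4v of 4 congruent to f solves 4v + e ≡ 0 modulo d.
    obtain ⟨z, hz4, hzd⟩ := Nat.chineseRemainder hd 0 f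
    obtain ⟨v, rfl⟩ := (Nat.modEq_zero_iff_dvd).1 hz4
    refine ⟨v, fun i => ?_⟩
    have h0 : 4 * v + e ≡ 0 [MOD d] := (hzd.add_right e).trans (Nat.modEq_zero_iff_dvd.2 hf)
    rw [← Nat.modEq_zero_iff_dvd]
    exact ⟨fun h => ((h.trans h0.symm).add_right_cancel' e).cancel_left_of_coprime hd.symm,
      fun h => ((h.mul_left 4).add_right e).trans h0⟩
  simp only [hv]
  rw [← Nat.count_eq_card_filter_range, Nat.count_modEq_card _ hd0]
  simp [Nat.mul_div_cancel _ hd0]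

/-- Isolates what depends on N alone; the rest becomes the k-th summand once the powers of q^N
reduce to 1. The first quotient stays whole because it may be 0/0 at ζ; its exponent 2 * 1 fits
`exists_specializesTo_qPochhammer_div`. -/
lemma truncatedTerm_add {F : Type*} [Field F] (q a : F) (N k : ℕ) : truncatedTerm q a (N + k) =
    ((qPochhammer (q ^ (2 * 1)) (q ^ 8) N / qPochhammer (q ^ 8) (q ^ 8) N) ^ 2 *
      (qPochhammer (a * q ^ 2) (q ^ 8) N * qPochhammer (q ^ 2 / a) (q ^ 8) N /
        (qPochhammer (a * q ^ 8) (q ^ 8) N * qPochhammer (q ^ 8 / a) (q ^ 8) N))) *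
    ((1 - q ^ (16 * N) * (q ^ 2) ^ (8 * k + 1)) / (1 - q ^ 2) *
      ((1 - q ^ (8 * N) * q ^ (8 * k + 1)) / (1 - q)) ^ 2 *
    ((qPochhammer (q ^ 2 * q ^ (8 * N)) (q ^ 8) k ^ 2 *
        qPochhammer (a * q ^ 2 * q ^ (8 * N)) (q ^ 8) k *
        qPochhammer (q ^ 2 / a * q ^ (8 * N)) (q ^ 8) k) /
      (qPochhammer (q ^ 8 * q ^ (8 * N)) (q ^ 8) k ^ 2 *
        qPochhammer (a * q ^ 8 * q ^ (8 * N)) (q ^ 8) k *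
        qPochhammer (q ^ 8 / a * q ^ (8 * N)) (q ^ 8) k)) *
    (q ^ (4 * N) * q ^ (4 * k))⁻¹) := by
  rw [truncatedTerm_eq]
  simp only [qPochhammer_add, ← pow_mul]
  rw [show q ^ (4 * N) * q ^ (4 * k) = q ^ (4 * (N + k)) by ring,
    show q ^ (8 * N) * q ^ (8 * k + 1) = q ^ (8 * (N + k) + 1) by ring,
    show q ^ (16 * N) * q ^ (2 * (8 * k + 1)) = q ^ (2 * (8 * (N + k) + 1)) by ring]
  generalize qPochhammer (_ : F) _ k = A₁
  generalize qPochhammer (_ : F) _ k = A₂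
  generalize qPochhammer (_ : F) _ k = A₃
  generalize qPochhammer (_ : F) _ k = A₄
  generalize qPochhammer (_ : F) _ k = A₅
  generalize qPochhammer (_ : F) _ k = A₆
  generalize 1 - q ^ (8 * (N + k) + 1) = B₁
  generalize 1 - q ^ (2 * (8 * (N + k) + 1)) = B₂
  generalize 1 - q ^ 2 = B₃
  generalize 1 - q = B₄
  ring

section Specialization

variable {R K L : Type*} [CommRing R] [Field K] [Algebra R K] [Field L] {φ : R →+* L} {q a : K}
  {ζ α : L} {d : ℕ}

/-- For j = ds the cofactor of 1 - q^(2d) is a geometric sum reducing to s, which is nonzero in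
characteristic zero. -/
lemma exists_specializesTo_one_sub_pow [CharZero L] (hq : SpecializesTo φ q ζ)
    (hd : ∀ j, ζ ^ (2 * j) = 1 ↔ d ∣ j) {j : ℕ} (hj : 0 < j) :
    ∃ (g : K) (γ : L), SpecializesTo φ g γ ∧ γ ≠ 0 ∧
      1 - q ^ (2 * j) = (if d ∣ j then 1 - q ^ (2 * d) else 1) * g := by
  split_ifs with h
  · obtain ⟨s, rfl⟩ := h
    refine ⟨∑ i ∈ range s, (q ^ (2 * d)) ^ i, ∑ i ∈ range s, (ζ ^ (2 * d)) ^ i,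
      .sum _ fun i _ => (hq.pow _).pow i, ?_, ?_⟩
    · rw [(hd d).2 dvd_rfl]
      simp only [one_pow, sum_const, card_range, nsmul_eq_mul, mul_one]
      exact Nat.cast_ne_zero.2 (by rintro rfl; simp at hj)
    · rw [mul_neg_geom_sum, ← pow_mul, mul_assoc]
  · exact ⟨_, _, SpecializesTo.one.sub (hq.pow _), sub_ne_zero.2 (Ne.symm (mt (hd j).1 h)),
      by rw [one_mul]⟩

lemma exists_specializesTo_prod [CharZero L] (hq : SpecializesTo φ q ζ)
    (hd : ∀ j, ζ ^ (2 * j) = 1 ↔ d ∣ j) (s : Finset ℕ) {e : ℕ → ℕ} (he : ∀ i, 0 < e i) :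
    ∃ (g : K) (γ : L), SpecializesTo φ g γ ∧ γ ≠ 0 ∧
      ∏ i ∈ s, (1 - q ^ (2 * e i)) = (1 - q ^ (2 * d)) ^ #{i ∈ s | d ∣ e i} * g := by
  choose g γ h1 h2 h3 using fun i => exists_specializesTo_one_sub_pow hq hd (he i)
  refine ⟨∏ i ∈ s, g i, ∏ i ∈ s, γ i, .prod _ fun i _ => h1 i, prod_ne_zero_iff.2 fun i _ => h2 i,
    ?_⟩
  rw [prod_congr rfl fun i _ => h3 i, prod_mul_distrib, prod_ite, prod_const, prod_const_one,
    mul_one]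

lemma qPochhammer_pow_eq_prod {F : Type*} [Field F] (q : F) (e k : ℕ) :
    qPochhammer (q ^ (2 * e)) (q ^ 8) k = ∏ i ∈ range k, (1 - q ^ (2 * (4 * i + e))) :=
  prod_congr rfl fun i _ => by ring

variable [IsDomain R] [IsFractionRing R K]

/-- Over l full periods, numerator and denominator each have l vanishing factors, so the powers of 1
- q^(2d) cancel. Only regularity matters, not the value. -/
lemma exists_specializesTo_qPochhammer_div [CharZero L] (hq : SpecializesTo φ q ζ)
    (hqK : ∀ j, q ^ (j + 1) ≠ 1) (hd : ∀ j, ζ ^ (2 * j) = 1 ↔ d ∣ j) (hd4 : Nat.Coprime 4 d)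
    (hd0 : 0 < d) {e : ℕ} (he : 0 < e) (l : ℕ) :
    ∃ y, SpecializesTo φ
      (qPochhammer (q ^ (2 * e)) (q ^ 8) (l * d) / qPochhammer (q ^ 8) (q ^ 8) (l * d)) y := by
  obtain ⟨g, γ, h1, -, h3⟩ := exists_specializesTo_prod hq hd (range (l * d))
    (e := fun i => 4 * i + e) (fun i => by omega)
  obtain ⟨g', γ', h1', h2', h3'⟩ := exists_specializesTo_prod hq hd (range (l * d))
    (e := fun i => 4 * i + 4) (fun i => by omega)
  refine ⟨γ / γ', ?_⟩
  have hθ : 1 - q ^ (2 * d) ≠ 0 := by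
    obtain ⟨j, hj⟩ := Nat.exists_eq_add_one_of_ne_zero (show 2 * d ≠ 0 by omega)
    rw [hj]; exact sub_ne_zero.2 (hqK j).symm
  rw [card_filter_dvd_four_mul_add hd4 hd0] at h3 h3'
  rw [qPochhammer_pow_eq_prod, h3, show q ^ 8 = q ^ (2 * 4) from rfl,
    show qPochhammer (q ^ (2 * 4)) (q ^ (2 * 4)) (l * d) = _ from qPochhammer_pow_eq_prod q 4 _,
    h3', mul_div_mul_left _ _ (pow_ne_zero _ hθ)]
  exact h1.div h1' h2'

/-- Modulo a prime at which `q ^ 2` becomes a root of unity of odd order `d`, a block of `d`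
consecutive summands is a constant multiple of the first block. -/
lemma exists_specializesTo_truncatedTerm_add [CharZero L] (hq : SpecializesTo φ q ζ)
    (ha : SpecializesTo φ a α) (hqK : ∀ j, q ^ (j + 1) ≠ 1)
    (hd : ∀ j, ζ ^ (2 * j) = 1 ↔ d ∣ j) (hd4 : Nat.Coprime 4 d) (hd1 : 1 < d)
    (hα0 : α ≠ 0) (hα : ∀ j, 1 - α * ζ ^ j ≠ 0) (hα' : ∀ j, 1 - ζ ^ j / α ≠ 0) (l : ℕ) :
    ∃ y, ∀ k < d, SpecializesTo φ (truncatedTerm q a (l * d + k)) (y * truncatedTerm ζ α k) := by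
  have hd0 : 0 < d := by omega
  obtain ⟨y, hy⟩ := exists_specializesTo_qPochhammer_div hq hqK hd hd4 hd0 one_pos l
  have hζ0 : ζ ≠ 0 := fun h => by
    have := (hd d).2 dvd_rfl
    rw [h, zero_pow (by omega)] at this
    exact zero_ne_one this
  have hζd : ∀ c, ζ ^ (2 * c * (l * d)) = 1 := fun c => by
    rw [mul_assoc]; exact (hd _).2 ((dvd_mul_left d l).mul_left c)
  have hp1 : 1 - ζ ^ 2 ≠ 0 := sub_ne_zero.2 fun h => by
    have := (hd 1).1 h.symm
    rw [Nat.dvd_one] at this; omega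
  have hζ1 : 1 - ζ ≠ 0 := fun h => hp1 (by linear_combination (1 + ζ) * h)
  have hden1 : ∀ N, qPochhammer (α * ζ ^ 8) (ζ ^ 8) N ≠ 0 := fun N => qPochhammer_ne_zero
    fun i _ => by rw [mul_assoc, ← pow_mul, ← pow_add]; exact hα _
  have hden2 : ∀ N, qPochhammer (ζ ^ 8 / α) (ζ ^ 8) N ≠ 0 := fun N => qPochhammer_ne_zero
    fun i _ => by rw [div_mul_eq_mul_div, ← pow_mul, ← pow_add]; exact hα' _
  refine ⟨y ^ 2 * (qPochhammer (α * ζ ^ 2) (ζ ^ 8) (l * d) *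
    qPochhammer (ζ ^ 2 / α) (ζ ^ 8) (l * d) / (qPochhammer (α * ζ ^ 8) (ζ ^ 8) (l * d) *
      qPochhammer (ζ ^ 8 / α) (ζ ^ 8) (l * d))), fun k hk => ?_⟩
  have hden3 : qPochhammer (ζ ^ 8) (ζ ^ 8) k ≠ 0 := qPochhammer_ne_zero fun i hi => by
    rw [sub_ne_zero, ← pow_mul, ← pow_add, ne_comm, show 8 + 8 * i = 2 * (4 * (i + 1)) by ring, Ne,
      hd]
    intro h
    exact absurd (Nat.le_of_dvd (by omega) (hd4.symm.dvd_of_dvd_mul_left h)) (by omega)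
  have h1 := SpecializesTo.one (φ := φ) (K := K)
  have s : ∀ c, SpecializesTo φ (q ^ (2 * c * (l * d))) 1 := fun c => by
    simpa only [hζd] using hq.pow (2 * c * (l * d))
  have s8 := s 4
  have s4 := s 2
  have s16 := s 8
  simp only [Nat.reduceMul] at s8 s4 s16
  rw [truncatedTerm_add, truncatedTerm_eq]
  refine ((hy.pow 2).mul ((((ha.mul (hq.pow 2)).qPochhammer (hq.pow 8) _).mul
    (((hq.pow 2).div ha hα0).qPochhammer (hq.pow 8) _)).div
    (((ha.mul (hq.pow 8)).qPochhammer (hq.pow 8) _).mul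
    (((hq.pow 8).div ha hα0).qPochhammer (hq.pow 8) _)) (mul_ne_zero (hden1 _) (hden2 _)))).mul ?_
  have t : ∀ {x : K} {y : L}, SpecializesTo φ x y →
      SpecializesTo φ (qPochhammer (x * q ^ (8 * (l * d))) (q ^ 8) k)
        (qPochhammer y (ζ ^ 8) k) := fun h => by
    simpa only [mul_one] using (h.mul s8).qPochhammer (hq.pow 8) k
  have u16 := s16.mul ((hq.pow 2).pow (8 * k + 1))
  have u8 := s8.mul (hq.pow (8 * k + 1))
  have u4 := s4.mul (hq.pow (4 * k))
  rw [one_mul] at u16 u8 u4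
  refine ((((h1.sub u16).div (h1.sub (hq.pow 2)) hp1).mul
    (((h1.sub u8).div (h1.sub hq) hζ1).pow 2)).mul
    (((((t (hq.pow 2)).pow 2).mul (t (ha.mul (hq.pow 2)))).mul (t ((hq.pow 2).div ha hα0))).div
    ((((t (hq.pow 8)).pow 2).mul (t (ha.mul (hq.pow 8)))).mul (t ((hq.pow 8).div ha hα0))) ?_)).mul
    (u4.inv (pow_ne_zero _ hζ0))
  exact mul_ne_zero (mul_ne_zero (pow_ne_zero _ hden3) (hden1 _)) (hden2 _)

/-- At a prime at which `q ^ 2` becomes a nontrivial root of unity of order `d ∣ 4 m + 1`, both the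
sum and its closed form vanish. -/
lemma specializesTo_sum_sub_closedForm [CharZero L] (hq : SpecializesTo φ q ζ)
    (ha : SpecializesTo φ a α) (hqK : ∀ j, q ^ (j + 1) ≠ 1)
    (hd : ∀ j, ζ ^ (2 * j) = 1 ↔ d ∣ j) (hd1 : 1 < d) {m : ℕ} (hdm : d ∣ 4 * m + 1)
    (hα0 : α ≠ 0) (hα : ∀ j, 1 - α * ζ ^ j ≠ 0) (hα' : ∀ j, 1 - ζ ^ j / α ≠ 0) :
    SpecializesTo φ (∑ k ∈ range (m + 1), truncatedTerm q a k - closedForm q a m) 0 := by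
  have hd0 : 0 < d := by omega
  have hd4 : Nat.Coprime 4 d := Nat.Coprime.coprime_dvd_right hdm (by simp)
  have hζ0 : ζ ≠ 0 := fun h => by
    have := (hd d).2 dvd_rfl
    rw [h, zero_pow (by omega)] at this
    exact zero_ne_one this
  obtain ⟨l, M, hM, rfl⟩ : ∃ l M, M < d ∧ m = l * d + M :=
    ⟨m / d, m % d, Nat.mod_lt _ hd0, by rw [mul_comm]; exact (Nat.div_add_mod m d).symm⟩
  have hdM : d ∣ 4 * M + 1 := by
    rw [show 4 * (l * d + M) + 1 = 4 * l * d + (4 * M + 1) by ring] at hdm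
    exact (Nat.dvd_add_right (dvd_mul_left d _)).1 hdm
  have hζM : ζ ^ (8 * M + 2) = 1 := by
    rw [show 8 * M + 2 = 2 * (4 * M + 1) by ring]; exact (hd _).2 hdM
  have h8 : ∀ i, i + 1 < d → ζ ^ (8 * (i + 1)) ≠ 1 := fun i hi => by
    rw [show 8 * (i + 1) = 2 * (4 * (i + 1)) by ring, Ne, hd]
    intro h
    exact absurd (Nat.le_of_dvd (by omega) (hd4.symm.dvd_of_dvd_mul_left h)) (by omega)
  have hzero : ∑ k ∈ range (M + 1), truncatedTerm ζ α k = 0 :=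
    sum_truncatedTerm_eq_zero hα0 hζM
      (fun i hi => sub_ne_zero.2 (by
        rw [← pow_mul, ← pow_add, show 8 + 8 * i = 8 * (i + 1) by ring]
        exact (h8 i (by omega)).symm))
      (fun i _ => by rw [mul_assoc, ← pow_mul, ← pow_add]; exact hα _)
      (fun i _ => by rw [div_mul_eq_mul_div, ← pow_mul, ← pow_add]; exact hα' _)
  -- Serves both for complete blocks (r = d) and for the last one (r = M + 1): beyond M the reduced
  -- summands vanish.
  have hblock : ∀ l r, M < r → r ≤ d →
      SpecializesTo φ (∑ k ∈ range r, truncatedTerm q a (l * d + k)) 0 := fun l r hMr hr => by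
    obtain ⟨y, hy⟩ := exists_specializesTo_truncatedTerm_add hq ha hqK hd hd4 hd1 hα0 hα hα' l
    have := SpecializesTo.sum (range r) fun k hk => hy k ((mem_range.1 hk).trans_le hr)
    rwa [← mul_sum, ← sum_subset (range_subset_range.2 hMr) fun k _ hk => truncatedTerm_eq_zero hζM
      (by simpa using hk), hzero, mul_zero] at this
  have hblocks : ∀ l, SpecializesTo φ (∑ k ∈ range (l * d), truncatedTerm q a k) 0 := fun l => by
    induction l with
    | zero => simpa using SpecializesTo.zero
    | succ l ih =>
      rw [add_one_mul, sum_range_add]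
      simpa using ih.add (hblock l d hM le_rfl)
  have hsum : SpecializesTo φ (∑ k ∈ range (l * d + M + 1), truncatedTerm q a k) 0 := by
    rw [add_assoc, sum_range_add]
    simpa using (hblocks l).add (hblock l (M + 1) (by omega) (by omega))
  have h1 := SpecializesTo.one (φ := φ) (K := K)
  have hp1 : 1 - ζ ^ 2 ≠ 0 := sub_ne_zero.2 fun h => by
    have := (hd 1).1 h.symm
    rw [Nat.dvd_one] at this; omega
  have hζ1 : 1 - ζ ≠ 0 := fun h => hp1 (by linear_combination (1 + ζ) * h)
  have hp2 : 1 + ζ ^ 2 ≠ 0 := fun h => by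
    have h4 : ζ ^ (2 * 2) = 1 := by linear_combination (ζ ^ 2 - 1) * h
    have := Nat.Coprime.eq_one_of_dvd (hd4.symm.coprime_dvd_right (by norm_num : 2 ∣ 4))
      ((hd 2).1 h4)
    omega
  obtain ⟨y, hy⟩ := exists_specializesTo_qPochhammer_div hq hqK hd hd4 hd0 two_pos l
  simp only [Nat.reduceMul] at hy
  have hζd : ζ ^ (8 * (l * d)) = 1 := by
    rw [show 8 * (l * d) = 2 * (4 * l * d) by ring]; exact (hd _).2 (dvd_mul_left d _)
  have hclosed : SpecializesTo φ (closedForm q a (l * d + M)) 0 := by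
    have hn : SpecializesTo φ
        ((1 - (q ^ 2) ^ (4 * (l * d + M) + 1)) / (1 - q ^ 2)) (0 : L) := by
      have := (h1.sub ((hq.pow 2).pow (4 * (l * d + M) + 1))).div (h1.sub (hq.pow 2)) hp1
      rwa [← pow_mul ζ, (hd _).2 hdm, sub_self, zero_div] at this
    have hden : qPochhammer (ζ ^ 8 * (ζ ^ 8) ^ (l * d)) (ζ ^ 8) M ≠ 0 :=
      qPochhammer_ne_zero fun i hi => by
        rw [← pow_mul, hζd, mul_one, ← pow_mul, ← pow_add, show 8 + 8 * i = 8 * (i + 1) by ring]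
        exact sub_ne_zero.2 (h8 i (by omega)).symm
    have hQ := (((hq.pow 4).mul ((hq.pow 8).pow (l * d))).qPochhammer (hq.pow 8) M).div
      (((hq.pow 8).mul ((hq.pow 8).pow (l * d))).qPochhammer (hq.pow 8) M) hden
    have hfac := h1.sub (((h1.sub (ha.mul (hq.pow 2))).mul (h1.sub ((hq.pow 2).div ha hα0))).div
      (((h1.sub hq).pow 2).mul (h1.add (hq.pow 2))) (mul_ne_zero (pow_ne_zero 2 hζ1) hp2))
    have := ((hn.mul (hy.mul hQ)).mul
      ((hq.pow (2 * (l * d + M))).inv (pow_ne_zero _ hζ0))).mul hfac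
    rw [zero_mul, zero_mul, zero_mul, div_mul_div_comm, ← qPochhammer_add, ← qPochhammer_add] at this
    rw [closedForm, qInteger_natCast]
    exact this
  simpa using hsum.sub hclosed

end Specialization

/-! ### Divisibility in ℤ[q, a] and squarefreeness of the modulus. -/

namespace MvPolynomial

/-- If a divisor of a nonzero polynomial not involving the variable `i` divides `g`, then it
divides every polynomial obtained from `g` by a substitution for the variable `i`. -/
lemma dvd_aeval_update_of_degreeOf_eq_zero {σ R : Type*} [DecidableEq σ] [CommRing R] [IsDomain R]
    {i : σ} {f g π : MvPolynomial σ R} (hf : f ≠ 0) (hi : degreeOf i f = 0) (hπf : π ∣ f)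
    (hπg : π ∣ g) (t : MvPolynomial σ R) : π ∣ aeval (Function.update X i t) g := by
  have hπ : i ∉ π.vars := by
    obtain ⟨h, rfl⟩ := hπf
    rw [degreeOf_mul_eq (left_ne_zero_of_mul hf) (right_ne_zero_of_mul hf)] at hi
    rw [vars_def, Multiset.mem_toFinset, ← Multiset.count_eq_zero, ← degreeOf_def]
    omega
  have hfix : aeval (Function.update X i t) π = π :=
    hom_congr_vars (f₁ := (aeval (R := R) (Function.update X i t) :
        MvPolynomial σ R →ₐ[R] MvPolynomial σ R).toRingHom) (f₂ := RingHom.id _) (by ext; simp)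
      (fun j hj _ => by
        have : j ≠ i := fun h => hπ (h ▸ hj)
        simp [Function.update_of_ne this]) rfl
  obtain ⟨h, rfl⟩ := hπg
  rw [map_mul, hfix]
  exact dvd_mul_right _ _

end MvPolynomial

section PolyQA

open MvPolynomial

lemma X_zero_pow_sub_one_ne_zero {N : ℕ} (hN : N ≠ 0) : (X 0 ^ N - 1 : PolyQA) ≠ 0 := fun h => by
  have := congrArg (aeval (fun _ => (0 : ℤ))) h
  simp [hN] at this

lemma degreeOf_X_zero_pow_sub_one (N : ℕ) : degreeOf 1 (X 0 ^ N - 1 : PolyQA) = 0 := by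
  have h1 := degreeOf_sub_le 1 (X 0 ^ N : PolyQA) 1
  have h2 := degreeOf_pow_le 1 (X 0 : PolyQA) N
  rw [degreeOf_X_of_ne (by decide)] at h2
  rw [degreeOf_one] at h1
  omega

variable {f π : PolyQA}

lemma not_prime_dvd_X_one (hπ : Prime π) (hf : f ≠ 0) (hdeg : degreeOf 1 f = 0) (hπf : π ∣ f) :
    ¬ π ∣ X 1 := fun h => hπ.not_isUnit (isUnit_of_dvd_one (by
  simpa using dvd_aeval_update_of_degreeOf_eq_zero hf hdeg hπf h 1))

lemma not_prime_dvd_one_sub_mul_pow (hπ : Prime π) (hf : f ≠ 0) (hdeg : degreeOf 1 f = 0)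
    (hπf : π ∣ f) (j : ℕ) : ¬ π ∣ 1 - X 1 * X 0 ^ j := fun h => hπ.not_isUnit (isUnit_of_dvd_one (by
  simpa using dvd_aeval_update_of_degreeOf_eq_zero hf hdeg hπf h 0))

/-- The substitutions a = 1 and a = 0 give 1 - q^j and -q^j, whose difference is 1. -/
lemma not_prime_dvd_sub_pow (hπ : Prime π) (hf : f ≠ 0) (hdeg : degreeOf 1 f = 0)
    (hπf : π ∣ f) (j : ℕ) : ¬ π ∣ X 1 - X 0 ^ j := fun h => hπ.not_isUnit (isUnit_of_dvd_one (by
  have h0 := dvd_aeval_update_of_degreeOf_eq_zero hf hdeg hπf h 0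
  have h1 := dvd_aeval_update_of_degreeOf_eq_zero hf hdeg hπf h 1
  simpa using dvd_sub h1 h0))

lemma sq_dvd_pderiv {σ R : Type*} [CommRing R] {f π : MvPolynomial σ R} (i : σ)
    (h : π * π ∣ f) : π ∣ pderiv i f := by
  obtain ⟨g, rfl⟩ := h
  simp only [Derivation.leibniz, smul_eq_mul]
  exact ⟨π * pderiv i g + 2 * g * pderiv i π, by ring⟩

lemma squarefree_of_sq_not_dvd (hf : f ≠ 0) (h : ∀ π, Prime π → ¬ π * π ∣ f) : Squarefree f :=
  (squarefree_iff_irreducible_sq_not_dvd_of_ne_zero hf).2 fun π hπ => h π hπ.prime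

variable {n : ℕ}

lemma aeval_zero_geom_sum (hn : n ≠ 0) :
    aeval (Function.update (X : Fin 2 → PolyQA) 0 0) (∑ i ∈ range n, (X 0 ^ 2) ^ i : PolyQA) = 1 := by
  obtain ⟨k, rfl⟩ := Nat.exists_eq_succ_of_ne_zero hn
  simp [sum_range_succ']

lemma geom_sum_dvd (n : ℕ) : (∑ i ∈ range n, (X 0 ^ 2) ^ i : PolyQA) ∣ X 0 ^ (2 * n) - 1 :=
  ⟨X 0 ^ 2 - 1, by rw [geom_sum_mul, ← pow_mul]⟩

/-- The geometric sum has constant term 1, so no divisor of a nonzero integer that is a prime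
element can divide it. This yields characteristic zero for the residue field. -/
lemma not_prime_dvd_natCast (hn : n ≠ 0) (hπ : Prime π)
    (h : π ∣ ∑ i ∈ range n, (X 0 ^ 2) ^ i) {N : ℕ} (hN : N ≠ 0) : ¬ π ∣ (N : PolyQA) := fun h' => by
  have := dvd_aeval_update_of_degreeOf_eq_zero (i := 0) (Nat.cast_ne_zero.2 hN)
    (by rw [← map_natCast (C : ℤ →+* PolyQA), degreeOf_C]) h' h 0
  rw [aeval_zero_geom_sum hn] at this
  exact hπ.not_isUnit (isUnit_of_dvd_one this)

lemma geom_sum_ne_zero' (hn : n ≠ 0) : (∑ i ∈ range n, (X 0 ^ 2) ^ i : PolyQA) ≠ 0 := fun h => by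
  have := aeval_zero_geom_sum hn
  rw [h, map_zero] at this
  exact zero_ne_one this

lemma one_sub_mul_pow_ne_zero (j : ℕ) : (1 - X 1 * X 0 ^ j : PolyQA) ≠ 0 := fun h => by
  have := congrArg (aeval (fun _ => (0 : ℤ))) h
  simp at this

lemma sub_pow_ne_zero (j : ℕ) : (X 1 - X 0 ^ j : PolyQA) ≠ 0 := fun h => by
  have := congrArg (aeval ![(1 : ℤ), 0]) h
  simp at this

lemma squarefree_geom_sum (hn : n ≠ 0) : Squarefree (∑ i ∈ range n, (X 0 ^ 2) ^ i : PolyQA) :=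
  squarefree_of_sq_not_dvd (geom_sum_ne_zero' hn) fun π hπ h => by
    have h1 := sq_dvd_pderiv 0 (h.trans (geom_sum_dvd n))
    have h2 := (dvd_of_mul_left_dvd h).trans (geom_sum_dvd n)
    simp only [map_sub, Derivation.leibniz_pow, pderiv_X_self, Derivation.map_one_eq_zero,
      sub_zero, smul_eq_mul, mul_one, nsmul_eq_mul] at h1
    refine not_prime_dvd_natCast hn hπ (dvd_of_mul_left_dvd h) (N := 2 * n) (by omega) ?_
    -- For f = q^(2n) - 1, the combination q f' - 2n f is the integer 2n.
    have h3 := dvd_sub (h1.mul_right (X 0)) (h2.mul_left ((2 * n : ℕ) : PolyQA))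
    rwa [show ((2 * n : ℕ) : PolyQA) * X 0 ^ (2 * n - 1) * X 0 - ((2 * n : ℕ) : PolyQA) *
        (X 0 ^ (2 * n) - 1) = ((2 * n : ℕ) : PolyQA) by
      rw [mul_assoc, pow_sub_one_mul (by omega)]; ring] at h3

lemma squarefree_one_sub_mul_pow (j : ℕ) : Squarefree (1 - X 1 * X 0 ^ j : PolyQA) :=
  squarefree_of_sq_not_dvd (one_sub_mul_pow_ne_zero j) fun π hπ h => by
    have h1 := sq_dvd_pderiv 1 h
    have h2 := dvd_of_mul_left_dvd h
    have h3 : π ∣ X 0 ^ j := by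
      simpa [Derivation.leibniz, Derivation.leibniz_pow, pderiv_X_of_ne] using h1
    exact hπ.not_isUnit (isUnit_of_dvd_one (by simpa using dvd_add h2 (h3.mul_left (X 1))))

lemma squarefree_sub_pow (j : ℕ) : Squarefree (X 1 - X 0 ^ j : PolyQA) :=
  squarefree_of_sq_not_dvd (sub_pow_ne_zero j) fun π hπ h => by
    have h1 := sq_dvd_pderiv 1 h
    exact hπ.not_isUnit (isUnit_of_dvd_one (by
      simpa [Derivation.leibniz_pow, pderiv_X_of_ne] using h1))

lemma squarefree_modulus (hn : n ≠ 0) : Squarefree ((∑ i ∈ range n, (X 0 ^ 2) ^ i) *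
    (1 - X 1 * X 0 ^ (2 * n)) * (X 1 - X 0 ^ (2 * n)) : PolyQA) := by
  have hc0 := geom_sum_ne_zero' hn
  have hcop : ∀ π : PolyQA, Prime π → π ∣ ∑ i ∈ range n, (X 0 ^ 2) ^ i →
      ¬ π ∣ 1 - X 1 * X 0 ^ (2 * n) ∧ ¬ π ∣ X 1 - X 0 ^ (2 * n) := fun π hπ h => by
    have h0 := X_zero_pow_sub_one_ne_zero (N := 2 * n) (by omega)
    have hd := degreeOf_X_zero_pow_sub_one (2 * n)
    have h' := h.trans (geom_sum_dvd n)
    exact ⟨not_prime_dvd_one_sub_mul_pow hπ h0 hd h' _, not_prime_dvd_sub_pow hπ h0 hd h' _⟩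
  rw [squarefree_mul_iff, squarefree_mul_iff]
  refine ⟨?_, ⟨?_, squarefree_geom_sum hn, squarefree_one_sub_mul_pow _⟩, squarefree_sub_pow _⟩
  · refine (UniqueFactorizationMonoid.isRelPrime_iff_no_prime_factors
      (mul_ne_zero hc0 (one_sub_mul_pow_ne_zero _))).2 fun π h h' hπ => ?_
    rcases hπ.dvd_or_dvd h with h | h
    · exact (hcop π hπ h).2 h'
    · refine not_prime_dvd_sub_pow hπ (X_zero_pow_sub_one_ne_zero (N := 4 * n) (by omega))
        (degreeOf_X_zero_pow_sub_one _) ?_ _ h'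
      -- A common prime of the two linear factors would divide (1 - a q^(2n)) + (a - q^(2n)) q^(2n)
      -- = 1 - q^(4n), which is free of a.
      have := dvd_add h (h'.mul_right (X 0 ^ (2 * n)))
      rw [← dvd_neg]
      convert this using 1
      ring
  · exact (UniqueFactorizationMonoid.isRelPrime_iff_no_prime_factors hc0).2 fun π h h' hπ =>
      (hcop π hπ h).1 h'

end PolyQA

/-! ### Primes dividing the linear factors. -/

section Generic

variable {R K L : Type*} [CommRing R] [IsDomain R] [Field K] [Algebra R K] [IsFractionRing R K]
  [Field L] {φ : R →+* L} {q a : K} {ζ α : L}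

/-- At a prime factor of `(1 - a q ^ (2 n)) (a - q ^ (2 n))`, where `n = 4 m + 1`, the sum and its
closed form have the same reduction. -/
lemma specializesTo_sum_sub_closedForm_of_eq (hq : SpecializesTo φ q ζ) (ha : SpecializesTo φ a α)
    (hζ0 : ζ ≠ 0) (hζ : ∀ k, ζ ^ (k + 1) ≠ 1) {m : ℕ}
    (hα : α = ζ ^ (8 * m + 2) ∨ α * ζ ^ (8 * m + 2) = 1) :
    SpecializesTo φ (∑ k ∈ range (m + 1), truncatedTerm q a k - closedForm q a m) 0 := by
  have h1 := SpecializesTo.one (φ := φ) (K := K)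
  have hne : ∀ j, j ≠ 0 → 1 - ζ ^ j ≠ 0 := fun j hj => by
    obtain ⟨k, rfl⟩ := Nat.exists_eq_succ_of_ne_zero hj
    exact sub_ne_zero.2 (hζ k).symm
  have hinj : ∀ i j, ζ ^ i = ζ ^ j → i = j := by
    intro i j h
    wlog hij : i ≤ j generalizing i j
    · exact (this j i h.symm (by omega)).symm
    obtain ⟨k, rfl⟩ := Nat.exists_eq_add_of_le hij
    rw [pow_add] at h
    by_contra hk
    exact hne k (by omega) (sub_eq_zero.2
      (mul_left_cancel₀ (pow_ne_zero i hζ0) (by rw [← h, mul_one])).symm)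
  have hα0 : α ≠ 0 := by
    rcases hα with rfl | hα
    · exact pow_ne_zero _ hζ0
    · exact left_ne_zero_of_mul_eq_one hα
  -- A zero would force either a positive power of ζ to be 1 or 8i + 8 = 8m + 2, impossible modulo
  -- 8.
  have hα1 : ∀ i, 1 - α * ζ ^ 8 * (ζ ^ 8) ^ i ≠ 0 := fun i h => by
    rw [mul_assoc, ← pow_mul, ← pow_add, sub_eq_zero] at h
    rcases hα with rfl | hα
    · rw [← pow_add] at h
      exact hne _ (by omega) (sub_eq_zero.2 h)
    · have := hinj _ _ (mul_left_cancel₀ hα0 (hα.trans h))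
      omega
  have hα2 : ∀ i, 1 - ζ ^ 8 / α * (ζ ^ 8) ^ i ≠ 0 := fun i h => by
    rw [div_mul_eq_mul_div, ← pow_mul, ← pow_add, sub_eq_zero, eq_comm, div_eq_one_iff_eq hα0] at h
    rcases hα with rfl | hα
    · have := hinj _ _ h
      omega
    · rw [← h, ← pow_add] at hα
      exact hne _ (by omega) (sub_eq_zero.2 hα.symm)
  have hp1 := hne 2 two_ne_zero
  have hζ1 : 1 - ζ ≠ 0 := by simpa using hne 1 one_ne_zero
  have hp2 : 1 + ζ ^ 2 ≠ 0 := fun h => hne 4 (by norm_num) (by linear_combination (1 - ζ ^ 2) * h)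
  have hQ : ∀ k, qPochhammer (ζ ^ 8) (ζ ^ 8) k ≠ 0 := fun k => qPochhammer_ne_zero fun i _ => by
    rw [← pow_mul, ← pow_add]; exact hne _ (by omega)
  have hterm : ∀ k, SpecializesTo φ (truncatedTerm q a k) (truncatedTerm ζ α k) := fun k => by
    rw [truncatedTerm_eq, truncatedTerm_eq]
    have t : ∀ {x : K} {y : L}, SpecializesTo φ x y →
      SpecializesTo φ (qPochhammer x (q ^ 8) k) (qPochhammer y (ζ ^ 8) k) := fun h =>
        h.qPochhammer (hq.pow 8) k
    exact ((((h1.sub ((hq.pow 2).pow _)).div (h1.sub (hq.pow 2)) hp1).mul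
      (((h1.sub (hq.pow _)).div (h1.sub hq) hζ1).pow 2)).mul
      (((((t (hq.pow 2)).pow 2).mul (t (ha.mul (hq.pow 2)))).mul (t ((hq.pow 2).div ha hα0))).div
      ((((t (hq.pow 8)).pow 2).mul (t (ha.mul (hq.pow 8)))).mul (t ((hq.pow 8).div ha hα0)))
      (mul_ne_zero (mul_ne_zero (pow_ne_zero _ (hQ k)) (qPochhammer_ne_zero fun i _ => hα1 i))
        (qPochhammer_ne_zero fun i _ => hα2 i)))).mul
      ((hq.pow _).inv (pow_ne_zero _ hζ0))
  have hclosed : SpecializesTo φ (closedForm q a m) (closedForm ζ α m) := by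
    rw [closedForm, closedForm, qInteger_natCast, qInteger_natCast]
    exact ((((h1.sub ((hq.pow 2).pow _)).div (h1.sub (hq.pow 2)) hp1).mul
      (((hq.pow 4).qPochhammer (hq.pow 8) m).div ((hq.pow 8).qPochhammer (hq.pow 8) m) (hQ m))).mul
      ((hq.pow _).inv (pow_ne_zero _ hζ0))).mul
      (h1.sub (((h1.sub (ha.mul (hq.pow 2))).mul (h1.sub ((hq.pow 2).div ha hα0))).div
      (((h1.sub hq).pow 2).mul (h1.add (hq.pow 2))) (mul_ne_zero (pow_ne_zero 2 hζ1) hp2)))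
  have := (SpecializesTo.sum (range (m + 1)) fun k _ => hterm k).sub hclosed
  rwa [sum_truncatedTerm hζ0 hζ m hα, sub_self] at this

end Generic

/-! ### The congruence, by cases on the prime factor. -/

open MvPolynomial in
theorem theorem4 (n : ℕ) (hn : n ≡ 1 [MOD 4]) (q a : RatQA) (hq : q = varQ) (ha : a = varA) :
    FracCongr PolyQA
      (∑ k ∈ Finset.range ((n - 1) / 4 + 1),
        qInteger (q ^ 2) (8 * (k : ℤ) + 1) * qInteger q (8 * (k : ℤ) + 1) ^ 2 *
          ((qPochhammer (q ^ 2) (q ^ 8) k ^ 2 * qPochhammer (a * q ^ 2) (q ^ 8) k *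
              qPochhammer (q ^ 2 / a) (q ^ 8) k) /
            (qPochhammer (q ^ 8) (q ^ 8) k ^ 2 * qPochhammer (a * q ^ 8) (q ^ 8) k *
              qPochhammer (q ^ 8 / a) (q ^ 8) k)) *
          q ^ (-(4 * (k : ℤ))))
      (qInteger (q ^ 2) (n : ℤ) *
        (qPochhammer (q ^ 4) (q ^ 8) ((n - 1) / 4) / qPochhammer (q ^ 8) (q ^ 8) ((n - 1) / 4)) *
        q ^ (-(((n : ℤ) - 1) / 2)) *
        (1 - ((1 - a * q ^ 2) * (1 - q ^ 2 / a)) / ((1 - q) ^ 2 * (1 + q ^ 2))))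
      (qInteger (q ^ 2) (n : ℤ) * (1 - a * q ^ (2 * n)) * (a - q ^ (2 * n))) := by
  obtain ⟨m, rfl⟩ : ∃ m, n = 4 * m + 1 := ⟨n / 4, by unfold Nat.ModEq at hn; omega⟩
  have hn0 : 4 * m + 1 ≠ 0 := by omega
  have hqK : ∀ j, q ^ (j + 1) ≠ 1 := fun j h => by
    rw [hq, varQ, ← map_pow, ← map_one (algebraMap PolyQA RatQA)] at h
    exact X_zero_pow_sub_one_ne_zero (Nat.succ_ne_zero j)
      (sub_eq_zero.2 (IsFractionRing.injective PolyQA RatQA h))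
  have hmod : qInteger (q ^ 2) ((4 * m + 1 : ℕ) : ℤ) * (1 - a * q ^ (2 * (4 * m + 1))) *
      (a - q ^ (2 * (4 * m + 1))) = algebraMap PolyQA RatQA
        ((∑ i ∈ range (4 * m + 1), (X 0 ^ 2) ^ i) * (1 - X 1 * X 0 ^ (2 * (4 * m + 1))) *
          (X 1 - X 0 ^ (2 * (4 * m + 1)))) := by
    have hq2 : 1 - q ^ 2 ≠ 0 := sub_ne_zero.2 (hqK 1).symm
    rw [qInteger_natCast, ← mul_neg_geom_sum, mul_div_cancel_left₀ _ hq2, hq, ha]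
    simp only [map_mul, map_sub, map_sum, map_pow, map_one, varQ, varA]
  have hexp : q ^ (-((((4 * m + 1 : ℕ) : ℤ) - 1) / 2)) = (q ^ (2 * m))⁻¹ := by
    rw [show (((4 * m + 1 : ℕ) : ℤ) - 1) / 2 = ((2 * m : ℕ) : ℤ) by push_cast; omega, zpow_neg,
      zpow_natCast]
  rw [hmod, hexp, show (4 * m + 1 - 1) / 4 = m by omega]
  refine FracCongr.of_specializesTo (mul_ne_zero (mul_ne_zero (geom_sum_ne_zero' hn0)
    (one_sub_mul_pow_ne_zero _)) (sub_pow_ne_zero _)) (squarefree_modulus hn0) ?_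
  intro π hπ hdvd L _ φ hφ
  change SpecializesTo φ (∑ k ∈ range (m + 1), truncatedTerm q a k - closedForm q a m) 0
  have hqs : SpecializesTo φ q (φ (X 0)) := hq ▸ SpecializesTo.of_algebraMap φ (X 0)
  have has : SpecializesTo φ a (φ (X 1)) := ha ▸ SpecializesTo.of_algebraMap φ (X 1)
  -- A prime dividing a linear factor divides no nonzero polynomial in q alone; with f = q and f =
  -- q^(k+1) - 1, this keeps ζ away from 0 and roots of unity.
  have hroot : ∀ f : PolyQA, f ≠ 0 → degreeOf 1 f = 0 →
      (π ∣ 1 - X 1 * X 0 ^ (2 * (4 * m + 1)) ∨ π ∣ X 1 - X 0 ^ (2 * (4 * m + 1))) → φ f ≠ 0 :=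
    fun f hf hdeg h h0 => h.elim (not_prime_dvd_one_sub_mul_pow hπ hf hdeg ((hφ f).1 h0) _)
      (not_prime_dvd_sub_pow hπ hf hdeg ((hφ f).1 h0) _)
  have hlin : (π ∣ 1 - X 1 * X 0 ^ (2 * (4 * m + 1)) ∨ π ∣ X 1 - X 0 ^ (2 * (4 * m + 1))) →
      SpecializesTo φ (∑ k ∈ range (m + 1), truncatedTerm q a k - closedForm q a m) 0 := fun h => by
    refine specializesTo_sum_sub_closedForm_of_eq hqs has
      (hroot _ (X_ne_zero 0) (degreeOf_X_of_ne (by decide)) h) (fun k hk => ?_) ?_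
    · refine hroot _ (X_zero_pow_sub_one_ne_zero (Nat.succ_ne_zero k))
        (degreeOf_X_zero_pow_sub_one _) h ?_
      rw [map_sub, map_pow, map_one]
      exact sub_eq_zero.2 hk
    · rw [show 8 * m + 2 = 2 * (4 * m + 1) by ring]
      simp only [← hφ, map_sub, map_mul, map_pow, map_one, sub_eq_zero] at h
      exact h.symm.imp id Eq.symm
  rcases hπ.dvd_or_dvd hdvd with hdvd | h
  · rcases hπ.dvd_or_dvd hdvd with hdvd | h
    · have hX := hdvd.trans (geom_sum_dvd (4 * m + 1))
      have hX0 := X_zero_pow_sub_one_ne_zero (N := 2 * (4 * m + 1)) (by omega)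
      have hXd := degreeOf_X_zero_pow_sub_one (2 * (4 * m + 1))
      have : CharZero L := charZero_of_inj_zero fun N hN => by
        by_contra hN0
        rw [← map_natCast φ, hφ] at hN
        exact not_prime_dvd_natCast hn0 hπ hdvd hN0 hN
      have hα0 : φ (X 1) ≠ 0 := fun h => not_prime_dvd_X_one hπ hX0 hXd hX ((hφ _).1 h)
      have hζn : (φ (X 0) ^ 2) ^ (4 * m + 1) = 1 := by
        rw [← sub_eq_zero, ← pow_mul, ← map_pow, ← map_one φ, ← map_sub]
        exact (hφ _).2 hX
      have hd0 := orderOf_dvd_of_pow_eq_one hζn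
      refine specializesTo_sum_sub_closedForm (d := orderOf (φ (X 0) ^ 2)) hqs has hqK
        (fun j => by rw [pow_mul, orderOf_dvd_iff_pow_eq_one]) ?_ hd0 hα0 (fun j h => ?_)
        (fun j h => ?_)
      · have hne0 : orderOf (φ (X 0) ^ 2) ≠ 0 := fun h => by
          rw [h, zero_dvd_iff] at hd0; exact hn0 hd0
        -- If ζ² were 1, the geometric sum would reduce to n, which is nonzero in characteristic
        -- zero.
        have hne1 : orderOf (φ (X 0) ^ 2) ≠ 1 := fun h => by
          rw [orderOf_eq_one_iff] at h
          have h0 := (hφ _).2 hdvd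
          rw [map_sum] at h0
          simp only [map_pow, h, one_pow, sum_const, card_range, nsmul_eq_mul, mul_one] at h0
          exact hn0 (Nat.cast_eq_zero.1 h0)
        omega
      · refine not_prime_dvd_one_sub_mul_pow hπ hX0 hXd hX j ((hφ _).1 ?_)
        simpa using h
      · refine not_prime_dvd_sub_pow hπ hX0 hXd hX j ((hφ _).1 ?_)
        rw [sub_eq_zero, eq_comm, div_eq_one_iff_eq hα0] at h
        rw [map_sub, map_pow, h, sub_self]
    · exact hlin (.inl h)
  · exact hlin (.inr h)
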